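/- Let $L$ be the free Maxwell operator in $L^2(\mathbb R^3,\mathbb C^6)$, that is, $$L\binom{E}{B}=\frac1i\begin{pmatrix}0&-\mathrm{curl}\\ \mathrm{curl}&0\end{pmatrix}\binom{E}{B}$$ with domain $\{f\in L^2(\mathbb R^3,\mathbb C^6): Lf\in L^2(\mathbb R^3,\mathbb C^6)\}$, where $Lf$ is taken in the sense of distributions. Let $s>\frac12$. There is a constant $C=C_s>0$ such that the following holds for every $u_0\in L^2(\mathbb R^3,\mathbb C^6)$ that is orthogonal to $\ker L$. The Cauchy problem $$i\,u_t=Lu\quad(t\in\mathbb R),\qquad u(\cdot,0)=u_0,$$ has a unique solution $u$ (a continuous map $t\mapsto u(\cdot,t)$ from $\mathbb R$ to $L^2(\mathbb R^3,\mathbb C^6)$ that takes the value $u_0$ at $t=0$ and satisfies the equation in the sense that, for every Schwartz function $\varphi$ on $\mathbb R^3$, the pairing $t\mapsto\int_{\mathbb R^3}\varphi(x)\,u(x,t)\,dx$ is differentiable with $i\frac{d}{dt}\int_{\mathbb R^3}\varphi\,u(\cdot,t)\,dx=\langle Lu(\cdot,t),\varphi\rangle$, where $\langle\cdot,\cdot\rangle$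 is the bilinear pairing of tempered distributions with Schwartz functions, taken component by component), and $$\int_{\mathbb R}\int_{\mathbb R^3}(1+|x|^2)^{-s}\,|u(x,t)|^2\,dx\,dt\;\le\;C\,\|u_0\|_{L^2(\mathbb R^3,\mathbb C^6)}^2 .$$ -/

import Mathlib

open MeasureTheory
open scoped SchwartzMap LineDeriv ENNReal

noncomputable section

/-- Physical space `ℝ³` with the Euclidean norm. -/
abbrev Space3 : Type := EuclideanSpace ℝ (Fin 3)

/-- The index set of the six components of `(E, B)`: `Sum.inl j` is the `j`-th component of the
electric field `E`, and `Sum.inr j` is the `j`-th component of the magnetic field `B`. -/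
abbrev EBIndex : Type := Fin 3 ⊕ Fin 3

/-- `ℂ⁶ = ℂ³ ⊕ ℂ³` with its Hermitian norm. -/
abbrev EBValue : Type := EuclideanSpace ℂ EBIndex

/-- The Hilbert space `L²(ℝ³, ℂ⁶)`. -/
abbrev EBField : Type := Lp EBValue 2 (volume : Measure Space3)

/-- The six scalar components of a `ℂ⁶`-valued tempered distribution on `ℝ³`. -/
def ebComponents : 𝓢'(Space3, EBValue) →ₗ[ℂ] (EBIndex → 𝓢'(Space3, ℂ)) :=
  LinearMap.pi fun k =>
    (PointwiseConvergenceCLM.postcomp 𝓢(Space3, ℂ)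
      (EuclideanSpace.proj k : EBValue →L[ℂ] ℂ)).toLinearMap

/-- The partial derivative `∂/∂x_j` of a scalar tempered distribution on `ℝ³`. -/
def distPartial (j : Fin 3) : 𝓢'(Space3, ℂ) →ₗ[ℂ] 𝓢'(Space3, ℂ) :=
  (LineDeriv.lineDerivOpCLM ℂ 𝓢'(Space3, ℂ) (EuclideanSpace.single j (1 : ℝ))).toLinearMap

/-- The curl, in the sense of tempered distributions. -/
def distCurl : (Fin 3 → 𝓢'(Space3, ℂ)) →ₗ[ℂ] (Fin 3 → 𝓢'(Space3, ℂ)) where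
  toFun F := ![distPartial 1 (F 2) - distPartial 2 (F 1),
               distPartial 2 (F 0) - distPartial 0 (F 2),
               distPartial 0 (F 1) - distPartial 1 (F 0)]
  map_add' F G := by
    funext j
    fin_cases j <;> simp <;> abel
  map_smul' c F := by
    funext j
    fin_cases j <;> simp [smul_sub]

/-- The Maxwell differential expression `(1/i) (-curl B, curl E)`, acting on the six components of
`(E, B)` in the sense of tempered distributions. -/
def distMaxwell : (EBIndex → 𝓢'(Space3, ℂ)) →ₗ[ℂ] (EBIndex → 𝓢'(Space3, ℂ)) where
  toFun F := (1 / Complex.I) • Sum.elim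
    (-distCurl fun j => F (Sum.inr j))
    (distCurl fun j => F (Sum.inl j))
  map_add' F G := by
    funext k
    rcases k with k | k <;> fin_cases k <;> simp [distCurl, smul_sub, smul_add] <;> abel
  map_smul' c F := by
    funext k
    rcases k with k | k <;> fin_cases k <;>
      simp [distCurl, smul_sub, smul_comm c Complex.I]

/-- The six components of a field in `L²(ℝ³, ℂ⁶)`, as tempered distributions. -/
def fieldDist : EBField →ₗ[ℂ] (EBIndex → 𝓢'(Space3, ℂ)) :=
  ebComponents ∘ₗ (Lp.toTemperedDistributionCLM EBValue (volume : Measure Space3) 2).toLinearMap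

theorem fieldDist_apply (f : EBField) (k : EBIndex) (φ : 𝓢(Space3, ℂ)) :
    fieldDist f k φ = ∫ x, φ x * f x k := by
  have h : fieldDist f k φ = (EuclideanSpace.proj k : EBValue →L[ℂ] ℂ) (∫ x, φ x • f x) := by
    rw [← Lp.toTemperedDistribution_apply]
    rfl
  rw [h, ← ContinuousLinearMap.integral_comp_comm]
  · rfl
  · have h1 : MemLp φ 2 (volume : Measure Space3) := φ.memLp 2 volume
    exact memLp_one_iff_integrable.mp ((Lp.memLp f).smul h1)

theorem fieldDist_injective : Function.Injective fieldDist := by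
  intro f g h
  have hk : ∀ a b : 𝓢'(Space3, EBValue), ebComponents a = ebComponents b → a = b := by
    intro a b hab
    ext φ k
    have := congrArg (fun T => T φ) (congrFun hab k)
    exact this
  have h1 := hk _ _ h
  have h2 := Lp.ker_toTemperedDistributionCLM_eq_bot
    (F := EBValue) (μ := (volume : Measure Space3)) (p := 2)
  exact (LinearMap.ker_eq_bot.mp h2) h1

/-- The free Maxwell operator `L (E, B) = (1/i) (-curl B, curl E)` as an unbounded operator in
`L²(ℝ³, ℂ⁶)`: its domain consists of all the fields `f` for which `L f`, taken in the sense of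
distributions, is in `L²`. -/
def maxwellOperator : EBField →ₗ.[ℂ] EBField where
  domain := (LinearMap.range fieldDist).comap (distMaxwell ∘ₗ fieldDist)
  toFun := (LinearEquiv.ofInjective fieldDist fieldDist_injective).symm.toLinearMap ∘ₗ
    (distMaxwell ∘ₗ fieldDist).restrict (fun _ hf => hf)

theorem fieldDist_maxwellOperator (f : maxwellOperator.domain) :
    fieldDist (maxwellOperator f) = distMaxwell (fieldDist f) := by
  have h := (LinearEquiv.ofInjective fieldDist fieldDist_injective).apply_symm_apply
    ((distMaxwell ∘ₗ fieldDist).restrict (p := maxwellOperator.domain) (fun _ hf => hf) f)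
  exact congrArg Subtype.val h

/-- The kernel of the free Maxwell operator, a subspace of `L²(ℝ³, ℂ⁶)`. -/
def maxwellKernel : Submodule ℂ EBField :=
  (LinearMap.ker maxwellOperator.toFun).map maxwellOperator.domain.subtype

/-- `u` is a solution of `i u_t = L u`, `u(0) = u₀`, for data `u₀ ∈ L²(ℝ³, ℂ⁶)`: it is a continuous
curve in `L²(ℝ³, ℂ⁶)`, defined for all times, that takes the value `u₀` at time `0` and satisfies
the equation in the sense of distributions in `x`, that is, for every test function `φ` the pairing
`t ↦ ⟨u(t), φ⟩` is differentiable and `i (d/dt) ⟨u(t), φ⟩ = ⟨L u(t), φ⟩`, component by component. -/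
structure IsMaxwellSolution (u₀ : EBField) (u : ℝ → EBField) : Prop where
  continuous : Continuous u
  initial : u 0 = u₀
  equation : ∀ (k : EBIndex) (φ : 𝓢(Space3, ℂ)) (t : ℝ), ∃ d : ℂ,
    HasDerivAt (fun τ : ℝ => fieldDist (u τ) k φ) d t ∧
      Complex.I * d = distMaxwell (fieldDist (u t)) k φ

end

/-! Put `M = -iL = ∑ A_j ∂_j`, with constant symmetric `A_j`, so that the equation is `u_t = M u`.
On the Fourier side `M` is multiplication by a skew-adjoint matrix `A(ξ)`, and the solution operator
is the unitary `exp(tA(ξ))`. For data whose Fourier transform is smooth with compact support it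
gives an explicit smooth solution. Pairing an arbitrary weak solution with these explicit ones gives
uniqueness. The fields `M φ` with `φ` band-limited are dense in `(ker L)ᗮ`, and unitarity carries
solutions to the limit uniformly in time.

The estimate is a Morawetz multiplier argument. With a bounded radial field `X = h x`, `h =
2(1+|x|²)^(-1/2) - (1+|x|²)^(-s)`, put `q(t) = Re ⟨u, (∑ X_j A_j) u⟩`, twice the Poynting vector
tested against `X` up to sign. It is bounded by a multiple of `‖u₀‖²`. Data in the range of `M` keep
`E` and `B` divergence-free, and then integration by parts (`sum_morawetzField_sub_divergence`,
`le_morawetzProfile`) shows that `-q'` dominates the weighted energy. Integrating in time bounds the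
weighted norm. Divergence-freeness is where orthogonality to `ker L` enters: static gradient fields
never disperse. -/

open MeasureTheory Filter
open scoped SchwartzMap LineDeriv ENNReal FourierTransform Topology

/-! ### The equation in Hilbert-space weak form -/

/-- The coefficient matrices `A_j` in `-i L = ∑ j, A_j ∂_j`. -/
noncomputable def maxwellCoeff (j : Fin 3) : EBValue →L[ℂ] EBValue :=
  LinearMap.toContinuousLinearMap
    { toFun := fun v => WithLp.toLp 2 (Sum.elim
        (crossProduct (Pi.single j 1) fun i => v (Sum.inr i))
        (-crossProduct (Pi.single j 1) fun i => v (Sum.inl i)))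
      map_add' := fun v w => by
        ext k
        rcases k with k | k <;> fin_cases j <;> fin_cases k <;> simp [crossProduct] <;> ring
      map_smul' := fun c v => by
        ext k
        rcases k with k | k <;> fin_cases j <;> fin_cases k <;> simp [crossProduct] }

theorem maxwellCoeff_apply (j : Fin 3) (v : EBValue) : maxwellCoeff j v =
    WithLp.toLp 2 (Sum.elim (crossProduct (Pi.single j 1) fun i => v (Sum.inr i))
        (-crossProduct (Pi.single j 1) fun i => v (Sum.inl i))) := rfl

/-- The cross product with a fixed vector is antisymmetric; the opposite signs in the two
off-diagonal blocks turn this into symmetry. -/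
theorem inner_maxwellCoeff_left (j : Fin 3) (v w : EBValue) :
    inner ℂ (maxwellCoeff j v) w = inner ℂ v (maxwellCoeff j w) := by
  simp only [maxwellCoeff_apply, PiLp.inner_apply, Fintype.sum_sum_type, Fin.sum_univ_three]
  fin_cases j <;> simp [crossProduct] <;> ring

/-- The operator `-i L = ∑ j, A_j ∂_j` on Schwartz functions. -/
noncomputable def schwartzMaxwell : 𝓢(Space3, EBValue) →L[ℂ] 𝓢(Space3, EBValue) :=
  ∑ j : Fin 3, SchwartzMap.postcompCLM (maxwellCoeff j) ∘L
    LineDeriv.lineDerivOpCLM ℂ 𝓢(Space3, EBValue) (EuclideanSpace.single j (1 : ℝ))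

theorem schwartzMaxwell_apply (ψ : 𝓢(Space3, EBValue)) (x : Space3) :
    schwartzMaxwell ψ x = ∑ j, maxwellCoeff j ((∂_{EuclideanSpace.single j (1 : ℝ)} ψ) x) := by
  simp [schwartzMaxwell, Fin.sum_univ_three]

/-- The vector-valued Schwartz function `conj φ • e_k`. -/
noncomputable def testField (k : EBIndex) : 𝓢(Space3, ℂ) →L[ℝ] 𝓢(Space3, EBValue) :=
  SchwartzMap.postcompCLM
    ((ContinuousLinearMap.toSpanSingleton ℂ
      (EuclideanSpace.single k (1 : ℂ) : EBValue)).restrictScalars ℝ ∘L Complex.conjCLE.toContinuousLinearMap)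

theorem testField_apply (k : EBIndex) (φ : 𝓢(Space3, ℂ)) (x : Space3) :
    testField k φ x = (starRingEnd ℂ (φ x)) • EuclideanSpace.single k (1 : ℂ) := by
  simp [testField]

theorem lineDerivOp_postcompCLM {F G : Type*} [NormedAddCommGroup F] [NormedSpace ℝ F]
    [NormedAddCommGroup G] [NormedSpace ℝ G] (A : F →L[ℝ] G) (ψ : 𝓢(Space3, F)) (m : Space3) :
    ∂_{m} (SchwartzMap.postcompCLM A ψ) = SchwartzMap.postcompCLM A (∂_{m} ψ) := by
  ext1 x
  exact DFunLike.congr_fun ((A.hasFDerivAt (x := ψ x)).comp x (ψ.hasFDerivAt x)).fderiv m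

theorem lineDerivOp_testField (k : EBIndex) (φ : 𝓢(Space3, ℂ)) (m : Space3) :
    ∂_{m} (testField k φ) = testField k (∂_{m} φ) :=
  lineDerivOp_postcompCLM _ φ m

theorem inner_toLp_eq_integral (ψ : 𝓢(Space3, EBValue)) (f : EBField) :
    inner ℂ (ψ.toLp 2) f = ∫ x, inner ℂ (ψ x) (f x) := by
  rw [L2.inner_def]
  apply integral_congr_ae
  filter_upwards [ψ.coeFn_toLp 2] with x hx
  rw [hx]

theorem inner_testField (f : EBField) (k : EBIndex) (φ : 𝓢(Space3, ℂ)) :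
    inner ℂ ((testField k φ).toLp 2) f = fieldDist f k φ := by
  rw [inner_toLp_eq_integral, fieldDist_apply]
  simp [testField_apply, EuclideanSpace.inner_single_left, mul_comm]

theorem integrable_inner_schwartz (ψ : 𝓢(Space3, EBValue)) (f : EBField) :
    Integrable (fun x => inner ℂ (ψ x) (f x)) := by
  refine (L2.integrable_inner (𝕜 := ℂ) (ψ.toLp 2) f).congr ?_
  filter_upwards [ψ.coeFn_toLp 2] with x hx
  rw [hx]

/-- The minus sign of the distributional derivative, the symmetry of the `A_j` and `L = iM` combine
to the factor `-i`. The conjugate in `testField` turns the bilinear pairing into the inner product.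
-/
theorem inner_schwartzMaxwell_testField (f : EBField) (k : EBIndex) (φ : 𝓢(Space3, ℂ)) :
    distMaxwell (fieldDist f) k φ =
      -Complex.I * inner ℂ ((schwartzMaxwell (testField k φ)).toLp 2) f := by
  have key : ∀ (j : Fin 3) (l : EBIndex), ∫ x, (∂_{EuclideanSpace.single j (1 : ℝ)} φ : 𝓢(Space3, ℂ)) x * f x l =
    fieldDist f l (∂_{EuclideanSpace.single j (1 : ℝ)} φ : 𝓢(Space3, ℂ)) := fun j l => by
      rw [fieldDist_apply]
  have h1 : inner ℂ ((schwartzMaxwell (testField k φ)).toLp 2) f =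
      ∑ j, ∫ x, (∂_{EuclideanSpace.single j (1 : ℝ)} φ : 𝓢(Space3, ℂ)) x * maxwellCoeff j (f x) k := by
    rw [inner_toLp_eq_integral, ← integral_finsetSum]
    · refine integral_congr_ae (.of_forall fun x => ?_)
      simp only [schwartzMaxwell_apply, sum_inner, inner_maxwellCoeff_left, lineDerivOp_testField,
        testField_apply]
      simp [EuclideanSpace.inner_single_left, mul_comm]
    · intro j _
      refine (integrable_inner_schwartz
        (SchwartzMap.postcompCLM (maxwellCoeff j) (testField k (∂_{EuclideanSpace.single j (1 : ℝ)} φ : 𝓢(Space3, ℂ))))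
          f).congr (.of_forall fun x => ?_)
      simp [inner_maxwellCoeff_left, testField_apply, EuclideanSpace.inner_single_left, mul_comm]
  have hd : ∀ j l, distPartial j (fieldDist f l) φ =
      - fieldDist f l (∂_{EuclideanSpace.single j (1 : ℝ)} φ : 𝓢(Space3, ℂ)) := fun j l => by
    have : distPartial j (fieldDist f l) φ =
      fieldDist f l (-∂_{EuclideanSpace.single j (1 : ℝ)} φ) := rfl
    rw [this, map_neg]
  rw [h1, Fin.sum_univ_three]
  rcases k with k | k <;> fin_cases k <;>
    simp [distMaxwell, distCurl, hd, maxwellCoeff_apply, crossProduct, integral_neg, key] <;> ring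

/-- The complex conjugate of the `k`-th component of a Schwartz function. -/
noncomputable def conjComponent (k : EBIndex) : 𝓢(Space3, EBValue) →L[ℝ] 𝓢(Space3, ℂ) :=
  SchwartzMap.postcompCLM (Complex.conjCLE.toContinuousLinearMap ∘L
    (EuclideanSpace.proj k : EBValue →L[ℂ] ℂ).restrictScalars ℝ)

theorem sum_testField_conjComponent (ψ : 𝓢(Space3, EBValue)) :
    ∑ k, testField k (conjComponent k ψ) = ψ := by
  ext x l
  simp only [testField_apply, conjComponent, sum_apply, WithLp.ofLp_sum, Finset.sum_apply]
  rw [Finset.sum_eq_single l]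
  · simp
  · intro k _ hk
    simp [hk.symm]
  · simp

/-- Every vector-valued Schwartz function is a sum of fields `testField k φ`, so testing
componentwise is the same as testing with all of them. From here on the equation is used only in
this form. -/
theorem isMaxwellSolution_iff {u₀ : EBField} {u : ℝ → EBField} : IsMaxwellSolution u₀ u ↔
    Continuous u ∧ u 0 = u₀ ∧ ∀ (ψ : 𝓢(Space3, EBValue)) (t : ℝ),
      HasDerivAt (fun τ => inner ℂ (ψ.toLp 2) (u τ))
        (-inner ℂ ((schwartzMaxwell ψ).toLp 2) (u t)) t := by
  constructor
  · intro h
    refine ⟨h.continuous, h.initial, fun ψ t => ?_⟩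
    have h1 : ∀ f : EBField, inner ℂ (ψ.toLp 2) f =
        ∑ k, fieldDist f k (conjComponent k ψ) := fun f => by
      conv_lhs => rw [← sum_testField_conjComponent ψ]
      simp only [← inner_testField, ← SchwartzMap.toLpCLM_apply (𝕜 := ℂ), map_sum, sum_inner]
    have h2 : ∀ f : EBField, inner ℂ ((schwartzMaxwell ψ).toLp 2) f =
        ∑ k, inner ℂ ((schwartzMaxwell (testField k (conjComponent k ψ))).toLp 2) f := fun f => by
      conv_lhs => rw [← sum_testField_conjComponent ψ]
      simp only [← SchwartzMap.toLpCLM_apply (𝕜 := ℂ), map_sum, sum_inner]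
    simp only [h1, h2, ← Finset.sum_neg_distrib]
    refine HasDerivAt.fun_sum fun k _ => ?_
    obtain ⟨d, hd, hd'⟩ := h.equation k (conjComponent k ψ) t
    rw [inner_schwartzMaxwell_testField, neg_mul, ← mul_neg] at hd'
    rw [← mul_left_cancel₀ Complex.I_ne_zero hd']
    simpa only [inner_testField] using hd
  · rintro ⟨h1, h2, h3⟩
    refine ⟨h1, h2, fun k φ t =>
      ⟨-inner ℂ ((schwartzMaxwell (testField k φ)).toLp 2) (u t), ?_, ?_⟩⟩
    · simpa only [inner_testField] using h3 (testField k φ) t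
    · rw [inner_schwartzMaxwell_testField]; ring

/-! ### The Fourier symbol and its unitary exponential -/

/-- The Fourier symbol of the operator `-i L`. -/
noncomputable def maxwellSymbol (ξ : Space3) : EBValue →L[ℂ] EBValue :=
  (2 * Real.pi * Complex.I) • ∑ j, (ξ j : ℂ) • maxwellCoeff j

/-- Multiplication of a Schwartz function by the Fourier symbol of `-i L`. -/
noncomputable def symbolMul : 𝓢(Space3, EBValue) →L[ℂ] 𝓢(Space3, EBValue) :=
  ∑ j : Fin 3, SchwartzMap.postcompCLM (maxwellCoeff j) ∘L ((2 * Real.pi * Complex.I) •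
    SchwartzMap.smulLeftCLM EBValue fun ξ : Space3 =>
      ((inner ℝ ξ (EuclideanSpace.single j (1 : ℝ)) : ℝ) : ℂ))

theorem symbolMul_apply (g : 𝓢(Space3, EBValue)) (ξ : Space3) :
    symbolMul g ξ = maxwellSymbol ξ (g ξ) := by
  have h : ∀ j : Fin 3, (fun ξ : Space3 =>
      ((inner ℝ ξ (EuclideanSpace.single j (1 : ℝ)) : ℝ) : ℂ)).HasTemperateGrowth := fun j => by
    fun_prop
  have h2 := fun j => SchwartzMap.smulLeftCLM_apply_apply (F := EBValue) (h j) g ξ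
  simp only [symbolMul, maxwellSymbol, sum_apply, ContinuousLinearMap.comp_apply, smul_apply,
    SchwartzMap.postcompCLM_apply, h2, map_smul, Finset.smul_sum]
  simp [EuclideanSpace.inner_single_right]

theorem postcompCLM_fourierInv {F : Type*} [NormedAddCommGroup F] [NormedSpace ℂ F]
    [CompleteSpace F] (A : EBValue →L[ℂ] F) (g : 𝓢(Space3, EBValue)) :
    SchwartzMap.postcompCLM A (𝓕⁻ g) = 𝓕⁻ (SchwartzMap.postcompCLM A g) := by
  ext1 x
  simp only [SchwartzMap.postcompCLM_apply, SchwartzMap.fourierInv_coe, Real.fourierInv_eq]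
  rw [← ContinuousLinearMap.integral_comp_comm]
  · simp
  · have := (Real.fourierIntegral_convergent_iff (V := Space3) (μ := volume) (f := g) (-x)).2 g.integrable
    simpa using this

theorem schwartzMaxwell_fourierInv (g : 𝓢(Space3, EBValue)) :
    schwartzMaxwell (𝓕⁻ g) = 𝓕⁻ (symbolMul g) := by
  simp only [schwartzMaxwell, symbolMul, sum_apply, ContinuousLinearMap.comp_apply,
    LineDeriv.lineDerivOpCLM_apply, SchwartzMap.lineDerivOp_fourierInv_eq, postcompCLM_fourierInv]
  rw [FourierTransform.fourierInv_sum]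
  refine Finset.sum_congr rfl fun j _ => ?_
  congr 2
  rw [← SchwartzMap.smulLeftCLM_ofReal ℂ (by fun_prop)]
  rfl

theorem inner_maxwellSymbol_left (ξ : Space3) (v w : EBValue) :
    inner ℂ (maxwellSymbol ξ v) w = -inner ℂ v (maxwellSymbol ξ w) := by
  simp only [maxwellSymbol, smul_apply, sum_apply, inner_smul_left, inner_smul_right, sum_inner,
    inner_sum, inner_maxwellCoeff_left, map_mul, Complex.conj_I, Complex.conj_ofReal, map_ofNat]
  ring

section SkewExp

variable {H : Type*} [NormedAddCommGroup H] [InnerProductSpace ℂ H] [CompleteSpace H]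

theorem hasDerivAt_exp_smul_apply (A : H →L[ℂ] H) (t : ℝ) (v : H) :
    HasDerivAt (fun τ : ℝ => NormedSpace.exp ((τ : ℂ) • A) v)
      (NormedSpace.exp ((t : ℂ) • A) (A v)) t := by
  have h := (hasDerivAt_exp_smul_const A (t : ℂ)).scomp t Complex.ofRealCLM.hasDerivAt
  have h2 := ((ContinuousLinearMap.apply ℂ H v).restrictScalars ℝ).hasFDerivAt.comp_hasDerivAt t h
  simpa [Function.comp_def] using h2

theorem exp_smul_apply_comm (A : H →L[ℂ] H) (c : ℂ) (v : H) :
    NormedSpace.exp (c • A) (A v) = A (NormedSpace.exp (c • A) v) := by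
  let _ : NormedAlgebra ℚ (H →L[ℂ] H) := NormedAlgebra.restrictScalars ℚ ℂ _
  exact DFunLike.congr_fun (((Commute.refl A).smul_left c).exp_left).eq v

/-- The derivative of `‖exp(τA)v‖²` is `⟨Ae, e⟩ + ⟨e, Ae⟩` with `e = exp(τA)v`, which vanishes. -/
theorem norm_exp_smul_apply_of_skew (A : H →L[ℂ] H)
    (hA : ∀ v w, inner ℂ (A v) w = -inner ℂ v (A w)) (t : ℝ) (v : H) :
    ‖NormedSpace.exp ((t : ℂ) • A) v‖ = ‖v‖ := by
  have h : ∀ τ : ℝ, HasDerivAt (fun τ : ℝ => inner ℂ (NormedSpace.exp ((τ : ℂ) • A) v)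
      (NormedSpace.exp ((τ : ℂ) • A) v)) 0 τ := fun τ => by
    have h1 := hasDerivAt_exp_smul_apply A τ v
    refine (h1.inner ℂ h1).congr_deriv ?_
    rw [exp_smul_apply_comm, hA]
    ring
  have h2 := is_const_of_deriv_eq_zero (fun τ => (h τ).differentiableAt)
    (fun τ => (h τ).deriv) t 0
  simp only [inner_self_eq_norm_sq_to_K, Complex.ofReal_zero, zero_smul, NormedSpace.exp_zero,
    one_apply_eq_self] at h2
  exact (pow_left_inj₀ (norm_nonneg _) (norm_nonneg _) two_ne_zero).1 (by exact_mod_cast h2)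

end SkewExp

/-- The Fourier symbol `exp (t A(ξ))` of the Maxwell group. -/
noncomputable def maxwellExp (t : ℝ) (ξ : Space3) : EBValue →L[ℂ] EBValue :=
  NormedSpace.exp ((t : ℂ) • maxwellSymbol ξ)

theorem norm_maxwellExp_apply (t : ℝ) (ξ : Space3) (v : EBValue) :
    ‖maxwellExp t ξ v‖ = ‖v‖ :=
  norm_exp_smul_apply_of_skew _ (inner_maxwellSymbol_left ξ) t v

theorem maxwellExp_zero (ξ : Space3) (v : EBValue) : maxwellExp 0 ξ v = v := by
  have : ((0 : ℝ) : ℂ) • maxwellSymbol ξ = 0 := by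
    ext1 w
    simp
  rw [maxwellExp, this, NormedSpace.exp_zero]
  rfl

theorem hasDerivAt_maxwellExp_apply (t : ℝ) (ξ : Space3) (v : EBValue) :
    HasDerivAt (fun τ => maxwellExp τ ξ v) (maxwellExp t ξ (maxwellSymbol ξ v)) t :=
  hasDerivAt_exp_smul_apply (maxwellSymbol ξ) t v

theorem maxwellExp_maxwellSymbol (t : ℝ) (ξ : Space3) (v : EBValue) :
    maxwellExp t ξ (maxwellSymbol ξ v) = maxwellSymbol ξ (maxwellExp t ξ v) :=
  exp_smul_apply_comm _ _ v

theorem contDiff_maxwellSymbol {n : WithTop ℕ∞} : ContDiff ℝ n maxwellSymbol := by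
  unfold maxwellSymbol
  have : ∀ j : Fin 3, ContDiff ℝ n fun ξ : Space3 => (ξ j : ℂ) := fun j =>
    Complex.ofRealCLM.contDiff.comp (EuclideanSpace.proj j : Space3 →L[ℝ] ℝ).contDiff
  fun_prop

theorem contDiff_maxwellExp (t : ℝ) {n : WithTop ℕ∞} : ContDiff ℝ n (maxwellExp t) := by
  have h : ContDiff ℂ n (NormedSpace.exp : (EBValue →L[ℂ] EBValue) → _) :=
    contDiff_iff_contDiffAt.2 fun x => (NormedSpace.exp_analytic (𝕂 := ℂ) x).contDiffAt
  exact (h.restrict_scalars ℝ).comp (contDiff_maxwellSymbol.const_smul (t : ℂ))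

/-- A Taylor estimate from two applications of the mean value inequality. Unitarity leaves only
`A(ξ)²v` in the bound, with no constant depending on `ξ`. -/
theorem norm_maxwellExp_sub_sub_le (t τ : ℝ) (ξ : Space3) (v : EBValue) :
    ‖maxwellExp τ ξ v - maxwellExp t ξ v - (τ - t) • maxwellExp t ξ (maxwellSymbol ξ v)‖ ≤
      |τ - t| ^ 2 * ‖maxwellSymbol ξ (maxwellSymbol ξ v)‖ := by
  have lip : ∀ (w : EBValue) (r : ℝ), ‖maxwellExp r ξ w - maxwellExp t ξ w‖ ≤
      ‖maxwellSymbol ξ w‖ * |r - t| := fun w r =>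
    Convex.norm_image_sub_le_of_norm_hasDerivWithin_le (s := Set.univ)
      (fun x _ => (hasDerivAt_maxwellExp_apply x ξ w).hasDerivWithinAt)
      (fun x _ => (norm_maxwellExp_apply x ξ _).le) convex_univ (Set.mem_univ _) (Set.mem_univ _)
  have hd : ∀ r, HasDerivAt (fun r => maxwellExp r ξ v - (r - t) • maxwellExp t ξ (maxwellSymbol ξ v))
      (maxwellExp r ξ (maxwellSymbol ξ v) - maxwellExp t ξ (maxwellSymbol ξ v)) r := fun r => by
    refine ((hasDerivAt_maxwellExp_apply r ξ v).sub
      (((hasDerivAt_id r).sub_const t).smul_const _)).congr_deriv ?_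
    simp
  have := Convex.norm_image_sub_le_of_norm_hasDerivWithin_le (s := Set.uIcc t τ)
    (C := ‖maxwellSymbol ξ (maxwellSymbol ξ v)‖ * |τ - t|)
      (fun x _ => (hd x).hasDerivWithinAt)
      (fun x hx => (lip _ x).trans (by
        gcongr 1
        exact Set.abs_sub_left_of_mem_uIcc hx)) (convex_uIcc _ _) Set.left_mem_uIcc
        Set.right_mem_uIcc
  simp only [sub_self, zero_smul, sub_zero, Real.norm_eq_abs] at this
  calc _ = _ := by congr 1; abel
    _ ≤ _ := this
    _ = _ := by ring

/-! ### Evolution of band-limited data -/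

/-- Multiplication by the Fourier symbol of the Maxwell group at time `t`. -/
noncomputable def expMul (g : 𝓢(Space3, EBValue)) (hg : HasCompactSupport g) (t : ℝ) :
    𝓢(Space3, EBValue) :=
  HasCompactSupport.toSchwartzMap (f := fun ξ => maxwellExp t ξ (g ξ))
    (hg.mono fun ξ hξ h => hξ (by simp [h]))
    (((ContinuousLinearMap.restrictScalarsL ℂ EBValue EBValue ℝ ℝ).contDiff.comp
      (contDiff_maxwellExp t)).clm_apply (g.smooth ⊤))

theorem expMul_apply (g : 𝓢(Space3, EBValue)) (hg : HasCompactSupport g) (t : ℝ) (ξ : Space3) :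
    expMul g hg t ξ = maxwellExp t ξ (g ξ) := rfl

theorem norm_toLp_le_of_norm_le {f g : 𝓢(Space3, EBValue)} {c : ℝ}
    (h : ∀ x, ‖f x‖ ≤ c * ‖g x‖) : ‖f.toLp 2 volume‖ ≤ c * ‖g.toLp 2 volume‖ := by
  apply Lp.norm_le_mul_norm_of_ae_le_mul
  filter_upwards [f.coeFn_toLp 2, g.coeFn_toLp 2] with x hf hg
  rw [hf, hg]
  exact h x

/-- The pointwise Taylor remainder is at most `|τ - t|²` times `|A(ξ)² g(ξ)|`, which is square
integrable, so the difference quotients converge in `L²`. -/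
theorem hasDerivAt_expMul (g : 𝓢(Space3, EBValue)) (hg : HasCompactSupport g) (t : ℝ) :
    HasDerivAt (fun τ => (expMul g hg τ).toLp 2 volume) ((symbolMul (expMul g hg t)).toLp 2 volume) t := by
  rw [hasDerivAt_iff_isLittleO]
  refine Asymptotics.IsBigO.trans_isLittleO (g := fun τ => ‖τ - t‖ ^ 2) ?_
    (Asymptotics.isLittleO_pow_sub_sub t one_lt_two)
  refine Asymptotics.IsBigO.of_bound ‖(symbolMul (symbolMul g)).toLp 2 volume‖ (.of_forall fun τ => ?_)
  have h1 : (expMul g hg τ).toLp 2 volume - (expMul g hg t).toLp 2 volume -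
      (τ - t) • (symbolMul (expMul g hg t)).toLp 2 volume =
      (expMul g hg τ - expMul g hg t - (τ - t) • symbolMul (expMul g hg t)).toLp 2 volume := by
    simp only [← SchwartzMap.toLpCLM_apply (𝕜 := ℝ), map_sub, map_smul]
  rw [h1, mul_comm]
  refine norm_toLp_le_of_norm_le fun ξ => ?_
  simp only [sub_apply, smul_apply, expMul_apply, symbolMul_apply, ← maxwellExp_maxwellSymbol]
  simpa using norm_maxwellExp_sub_sub_le t τ ξ (g ξ)

/-- The solution of the Maxwell equations whose data have Fourier transform `g`. -/
noncomputable def evolve (g : 𝓢(Space3, EBValue)) (hg : HasCompactSupport g) (t : ℝ) :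
    𝓢(Space3, EBValue) :=
  𝓕⁻ (expMul g hg t)

theorem evolve_zero (g : 𝓢(Space3, EBValue)) (hg : HasCompactSupport g) :
    evolve g hg 0 = 𝓕⁻ g := by
  rw [evolve]
  congr 1
  ext1 ξ
  rw [expMul_apply, maxwellExp_zero]

theorem hasDerivAt_evolve (g : 𝓢(Space3, EBValue)) (hg : HasCompactSupport g) (t : ℝ) :
    HasDerivAt (fun τ => (evolve g hg τ).toLp 2 volume) ((schwartzMaxwell (evolve g hg t)).toLp 2 volume) t := by
  simp only [evolve, schwartzMaxwell_fourierInv, ← SchwartzMap.toLp_fourierInv_eq]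
  exact ((Lp.fourierTransformₗᵢ Space3 EBValue).symm.toContinuousLinearEquiv.toContinuousLinearMap.restrictScalars
    ℝ).hasFDerivAt.comp_hasDerivAt t (hasDerivAt_expMul g hg t)

theorem norm_fourierInv_toLp (g : 𝓢(Space3, EBValue)) : ‖(𝓕⁻ g).toLp 2 volume‖ = ‖g.toLp 2 volume‖ := by
  rw [← SchwartzMap.toLp_fourierInv_eq]
  exact (Lp.fourierTransformₗᵢ Space3 EBValue).symm.norm_map _

theorem norm_evolve_sub_evolve (g g' : 𝓢(Space3, EBValue)) (hg : HasCompactSupport g)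
    (hg' : HasCompactSupport g') (t : ℝ) :
    ‖(evolve g hg t).toLp 2 volume - (evolve g' hg' t).toLp 2 volume‖ ≤
      ‖(𝓕⁻ g).toLp 2 volume - (𝓕⁻ g').toLp 2 volume‖ := by
  have h : ∀ a b : 𝓢(Space3, EBValue), (𝓕⁻ a).toLp 2 volume - (𝓕⁻ b).toLp 2 volume = (𝓕⁻ (a - b)).toLp 2 volume :=
    fun a b => by
      simp only [← SchwartzMap.toLpCLM_apply (𝕜 := ℂ),
        ← FourierTransform.fourierInvCLM_apply (R := ℂ), map_sub]
  rw [evolve, evolve, h, h, norm_fourierInv_toLp, norm_fourierInv_toLp, ← one_mul ‖(g - g').toLp 2 volume‖]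
  refine norm_toLp_le_of_norm_le fun ξ => ?_
  rw [sub_apply, expMul_apply, expMul_apply, ← map_sub, norm_maxwellExp_apply, sub_apply, one_mul]

theorem norm_evolve (g : 𝓢(Space3, EBValue)) (hg : HasCompactSupport g) (t : ℝ) :
    ‖(evolve g hg t).toLp 2 volume‖ ≤ ‖(𝓕⁻ g).toLp 2 volume‖ := by
  rw [evolve, norm_fourierInv_toLp, norm_fourierInv_toLp, ← one_mul ‖g.toLp 2 volume‖]
  exact norm_toLp_le_of_norm_le fun ξ => by rw [expMul_apply, norm_maxwellExp_apply, one_mul]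

theorem HasCompactSupport.symbolMul {g : 𝓢(Space3, EBValue)} (hg : HasCompactSupport g) :
    HasCompactSupport (symbolMul g) :=
  hg.mono fun ξ hξ h => hξ (by simp [symbolMul_apply, h])

/-- The group commutes with its generator, so a solution that starts in the range of `M` stays
there. -/
theorem evolve_symbolMul (g : 𝓢(Space3, EBValue)) (hg : HasCompactSupport g) (t : ℝ) :
    evolve (symbolMul g) hg.symbolMul t = schwartzMaxwell (evolve g hg t) := by
  rw [evolve, evolve, schwartzMaxwell_fourierInv]
  congr 1
  ext1 ξ
  rw [expMul_apply, symbolMul_apply, symbolMul_apply, expMul_apply, maxwellExp_maxwellSymbol]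

theorem inner_toLp_toLp (f g : 𝓢(Space3, EBValue)) :
    inner ℂ (f.toLp 2 volume) (g.toLp 2 volume) = ∫ x, inner ℂ (f x) (g x) := by
  rw [inner_toLp_eq_integral]
  apply integral_congr_ae
  filter_upwards [g.coeFn_toLp 2] with x hx
  rw [hx]

theorem inner_schwartzMaxwell_left (ψ χ : 𝓢(Space3, EBValue)) :
    inner ℂ ((schwartzMaxwell ψ).toLp 2 volume) (χ.toLp 2 volume) =
      -inner ℂ (ψ.toLp 2 volume) ((schwartzMaxwell χ).toLp 2 volume) := by
  rw [← (FourierTransform.fourierInv_fourier_eq ψ : 𝓕⁻ (𝓕 ψ : 𝓢(Space3, EBValue)) = ψ),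
    ← (FourierTransform.fourierInv_fourier_eq χ : 𝓕⁻ (𝓕 χ : 𝓢(Space3, EBValue)) = χ), schwartzMaxwell_fourierInv, schwartzMaxwell_fourierInv]
  simp only [← SchwartzMap.toLp_fourierInv_eq]
  have h : ∀ a b : EBField, inner ℂ (𝓕⁻ a) (𝓕⁻ b) = inner ℂ a b :=
    (Lp.fourierTransformₗᵢ Space3 EBValue).symm.inner_map_map
  rw [h, h, inner_toLp_toLp, inner_toLp_toLp, ← integral_neg]
  simp only [symbolMul_apply, inner_maxwellSymbol_left]

theorem isMaxwellSolution_evolve (g : 𝓢(Space3, EBValue)) (hg : HasCompactSupport g) :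
    IsMaxwellSolution ((𝓕⁻ g).toLp 2 volume) fun t => (evolve g hg t).toLp 2 volume := by
  rw [isMaxwellSolution_iff]
  refine ⟨continuous_iff_continuousAt.2 fun t => (hasDerivAt_evolve g hg t).continuousAt,
    by rw [evolve_zero], fun ψ t => ?_⟩
  refine ((hasDerivAt_const t (ψ.toLp 2 volume)).inner ℂ (hasDerivAt_evolve g hg t)).congr_deriv ?_
  rw [inner_zero_left, add_zero, inner_schwartzMaxwell_left, neg_neg]

/-! ### Density of band-limited fields -/

/-- A smooth cutoff function which is `1` on the unit ball and vanishes far away. -/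
noncomputable def unitBump : ContDiffBump (0 : Space3) := ⟨1, 2, one_pos, one_lt_two⟩

/-- Multiplication by a smooth cutoff at radius `n + 1`. -/
noncomputable def cutoff (n : ℕ) : 𝓢(Space3, EBValue) →L[ℂ] 𝓢(Space3, EBValue) :=
  SchwartzMap.smulLeftCLM EBValue fun ξ : Space3 => ((unitBump (((n : ℝ) + 1)⁻¹ • ξ) : ℝ) : ℂ)

theorem hasCompactSupport_unitBump_smul (n : ℕ) :
    HasCompactSupport fun ξ : Space3 => unitBump (((n : ℝ) + 1)⁻¹ • ξ) :=
  unitBump.hasCompactSupport.comp_smul (by positivity)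

theorem hasTemperateGrowth_unitBump_smul (n : ℕ) :
    (fun ξ : Space3 => ((unitBump (((n : ℝ) + 1)⁻¹ • ξ) : ℝ) : ℂ)).HasTemperateGrowth :=
  ((hasCompactSupport_unitBump_smul n).comp_left Complex.ofReal_zero).hasTemperateGrowth
    (Complex.ofRealCLM.contDiff.comp (unitBump.contDiff.comp (contDiff_const_smul _)))

theorem cutoff_apply (n : ℕ) (g : 𝓢(Space3, EBValue)) (ξ : Space3) :
    cutoff n g ξ = ((unitBump (((n : ℝ) + 1)⁻¹ • ξ) : ℝ) : ℂ) • g ξ :=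
  SchwartzMap.smulLeftCLM_apply_apply (hasTemperateGrowth_unitBump_smul n) g ξ

theorem hasCompactSupport_cutoff (n : ℕ) (g : 𝓢(Space3, EBValue)) :
    HasCompactSupport (cutoff n g) :=
  (hasCompactSupport_unitBump_smul n).mono fun ξ hξ h => hξ (by simp [cutoff_apply, h])

theorem symbolMul_cutoff (n : ℕ) (g : 𝓢(Space3, EBValue)) :
    symbolMul (cutoff n g) = cutoff n (symbolMul g) := by
  ext1 ξ
  rw [symbolMul_apply, cutoff_apply, cutoff_apply, symbolMul_apply, map_smul]

theorem tendsto_cutoff (g : 𝓢(Space3, EBValue)) :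
    Tendsto (fun n => (cutoff n g).toLp 2 volume) atTop (𝓝 (g.toLp 2 volume)) := by
  have hw : (fun ξ : Space3 => 1 + ‖ξ‖ ^ 2).HasTemperateGrowth := by fun_prop
  set w : 𝓢(Space3, EBValue) := SchwartzMap.smulLeftCLM EBValue (fun ξ : Space3 => 1 + ‖ξ‖ ^ 2) g
    with hw_def
  -- The cutoff error vanishes for `|ξ| ≤ n + 1` and is at most `1 ≤ (1 + |ξ|²)/(n + 1)` beyond, so
  -- the weighted function `w` pays for the rate.
  have h : ∀ n : ℕ, ‖(cutoff n g).toLp 2 volume - g.toLp 2 volume‖ ≤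
      1 / ((n : ℝ) + 1) * ‖w.toLp 2 volume‖ := fun n => by
    have h1 : (cutoff n g).toLp 2 volume - g.toLp 2 volume = (cutoff n g - g).toLp 2 volume := by
      simp only [← SchwartzMap.toLpCLM_apply (𝕜 := ℂ), map_sub]
    rw [h1]
    refine norm_toLp_le_of_norm_le fun ξ => ?_
    have hn : (0 : ℝ) < n + 1 := by positivity
    have h2 : w ξ = (1 + ‖ξ‖ ^ 2) • g ξ := SchwartzMap.smulLeftCLM_apply_apply hw g ξ
    have h3 : cutoff n g ξ - g ξ = (unitBump (((n : ℝ) + 1)⁻¹ • ξ) - 1) • g ξ := by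
      rw [cutoff_apply, sub_smul, one_smul, Complex.coe_smul]
    rw [sub_apply, h3, h2, norm_smul, norm_smul, ← mul_assoc]
    gcongr
    rw [Real.norm_of_nonneg (by positivity : 0 ≤ 1 + ‖ξ‖ ^ 2), Real.norm_eq_abs,
      abs_sub_comm, abs_of_nonneg (sub_nonneg.2 unitBump.le_one)]
    by_cases hξ : ‖ξ‖ ≤ n + 1
    · rw [unitBump.one_of_mem_closedBall, sub_self]
      · positivity
      · rw [mem_closedBall_zero_iff, norm_smul, Real.norm_of_nonneg (by positivity)]
        change _ ≤ (1 : ℝ)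
        rw [inv_mul_le_iff₀ hn]
        simpa using hξ
    · have h4 := unitBump.nonneg' (((n : ℝ) + 1)⁻¹ • ξ)
      rw [one_div, inv_mul_eq_div, le_div_iff₀ hn]
      nlinarith [sq_nonneg (‖ξ‖ - 1), norm_nonneg ξ]
  rw [tendsto_iff_norm_sub_tendsto_zero]
  refine squeeze_zero (fun _ => norm_nonneg _) h ?_
  simpa using tendsto_one_div_add_atTop_nhds_zero_nat.mul_const ‖w.toLp 2 volume‖

theorem tendsto_fourierInv_cutoff (g : 𝓢(Space3, EBValue)) :
    Tendsto (fun n => (𝓕⁻ (cutoff n g) : 𝓢(Space3, EBValue)).toLp 2 volume) atTop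
      (𝓝 ((𝓕⁻ g : 𝓢(Space3, EBValue)).toLp 2 volume)) := by
  simp only [← SchwartzMap.toLp_fourierInv_eq]
  exact ((Lp.fourierTransformₗᵢ Space3 EBValue).symm.continuous.tendsto _).comp (tendsto_cutoff g)

/-- An `L²` field that is orthogonal to all band-limited Schwartz functions vanishes. -/
theorem eq_zero_of_inner_fourierInv_eq_zero {f : EBField}
    (h : ∀ g : 𝓢(Space3, EBValue), HasCompactSupport g →
      inner ℂ ((𝓕⁻ g : 𝓢(Space3, EBValue)).toLp 2 volume) f = 0) : f = 0 := by
  have h1 : ∀ ψ : 𝓢(Space3, EBValue), inner ℂ (ψ.toLp 2 volume) f = 0 := fun ψ => by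
    rw [← (FourierTransform.fourierInv_fourier_eq ψ : 𝓕⁻ (𝓕 ψ : 𝓢(Space3, EBValue)) = ψ)]
    refine tendsto_nhds_unique ((tendsto_fourierInv_cutoff (𝓕 ψ)).inner tendsto_const_nhds) ?_
    simp only [h _ (hasCompactSupport_cutoff _ _), tendsto_const_nhds]
  have h2 : DenseRange (SchwartzMap.toLpCLM ℂ EBValue 2 (volume : Measure Space3)) :=
    SchwartzMap.denseRange_toLpCLM ENNReal.ofNat_ne_top
  exact h2.eq_zero_of_inner_left ℂ fun ψ => inner_eq_zero_symm.1 (h1 ψ)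

/-- Fields that are orthogonal to the image of `L` on band-limited functions are in `ker L`. -/
theorem mem_maxwellKernel_of_inner_eq_zero {f : EBField}
    (h : ∀ g : 𝓢(Space3, EBValue), HasCompactSupport g →
      inner ℂ ((𝓕⁻ (symbolMul g) : 𝓢(Space3, EBValue)).toLp 2 volume) f = 0) :
    f ∈ maxwellKernel := by
  have h1 : ∀ ψ : 𝓢(Space3, EBValue), inner ℂ ((schwartzMaxwell ψ).toLp 2 volume) f = 0 := fun ψ => by
    rw [← (FourierTransform.fourierInv_fourier_eq ψ : 𝓕⁻ (𝓕 ψ : 𝓢(Space3, EBValue)) = ψ),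
      schwartzMaxwell_fourierInv]
    refine tendsto_nhds_unique
      ((tendsto_fourierInv_cutoff (symbolMul (𝓕 ψ))).inner tendsto_const_nhds) ?_
    simp only [← symbolMul_cutoff, h _ (hasCompactSupport_cutoff _ _), tendsto_const_nhds]
  have h2 : distMaxwell (fieldDist f) = 0 := by
    ext k φ
    rw [inner_schwartzMaxwell_testField, h1, mul_zero]
    rfl
  have h3 : f ∈ maxwellOperator.domain := by
    refine ⟨0, ?_⟩
    rw [map_zero]
    exact h2.symm
  refine ⟨⟨f, h3⟩, ?_, rfl⟩
  apply fieldDist_injective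
  rw [map_zero]
  exact (fieldDist_maxwellOperator ⟨f, h3⟩).trans h2

/-- The space of all the fields `L φ` with a band-limited Schwartz function `φ`. -/
noncomputable def bandLimitedRange : Submodule ℂ EBField where
  carrier := {f | ∃ g : 𝓢(Space3, EBValue), HasCompactSupport g ∧
    (𝓕⁻ (symbolMul g) : 𝓢(Space3, EBValue)).toLp 2 volume = f}
  zero_mem' := ⟨0, HasCompactSupport.zero, by
    simp only [← SchwartzMap.toLpCLM_apply (𝕜 := ℂ),
      ← FourierTransform.fourierInvCLM_apply (R := ℂ), map_zero]⟩
  add_mem' := by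
    rintro _ _ ⟨a, ha, rfl⟩ ⟨b, hb, rfl⟩
    exact ⟨a + b, ha.add hb, by
      simp only [← SchwartzMap.toLpCLM_apply (𝕜 := ℂ),
        ← FourierTransform.fourierInvCLM_apply (R := ℂ), map_add]⟩
  smul_mem' := by
    rintro c _ ⟨a, ha, rfl⟩
    exact ⟨c • a, ha.smul_left (f := fun _ => c), by
      simp only [← SchwartzMap.toLpCLM_apply (𝕜 := ℂ),
        ← FourierTransform.fourierInvCLM_apply (R := ℂ), map_smul]⟩

/-- The orthogonal complement of the range lies in `ker L`; taking complements again gives the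
closure of the range. -/
theorem mem_closure_bandLimitedRange {f : EBField} (hf : f ∈ maxwellKernelᗮ) :
    f ∈ closure (bandLimitedRange : Set EBField) := by
  have h1 : bandLimitedRangeᗮ ≤ maxwellKernel := fun v hv =>
    mem_maxwellKernel_of_inner_eq_zero fun g hg =>
      (Submodule.mem_orthogonal _ _).1 hv _ ⟨g, hg, rfl⟩
  have h2 := Submodule.orthogonal_le h1 hf
  rwa [Submodule.orthogonal_orthogonal_eq_closure] at h2

/-! ### Uniqueness and existence -/

/-- The product rule for a strongly differentiable curve paired with a continuous, weakly
differentiable one. -/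
theorem hasDerivAt_inner_of_weak {H : Type*} [NormedAddCommGroup H] [InnerProductSpace ℂ H]
    {a w : ℝ → H} {a' : H} {d : ℂ} {t : ℝ} (ha : HasDerivAt a a' t) (hw : ContinuousAt w t)
    (hd : HasDerivAt (fun τ => inner ℂ (a t) (w τ)) d t) :
    HasDerivAt (fun τ => inner ℂ (a τ) (w τ)) (inner ℂ a' (w t) + d) t := by
  -- Only the part with `a τ - a t` needs strong convergence of the difference quotients of `a`;
  -- there, continuity of `w` suffices.
  have h1 : HasDerivAt (fun τ => inner ℂ (a τ - a t) (w τ)) (inner ℂ a' (w t)) t := by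
    rw [hasDerivAt_iff_tendsto_slope] at ha ⊢
    refine (ha.inner (hw.tendsto.mono_left nhdsWithin_le_nhds)).congr fun τ => ?_
    simp [slope_def_module, inner_smul_left_eq_smul, inner_sub_left]
  refine (h1.add hd).congr_of_eventuallyEq (.of_forall fun τ => ?_)
  simp

/-- Duality: pairing `w` with the smooth solution that equals `𝓕⁻ g` at time `T` gives a function of
time with zero derivative. It vanishes at time `0`, so `w T` is orthogonal to every `𝓕⁻ g`. -/
theorem IsMaxwellSolution.eq_zero {w : ℝ → EBField} (hw : IsMaxwellSolution 0 w) (T : ℝ) :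
    w T = 0 := by
  obtain ⟨h1, h2, h3⟩ := isMaxwellSolution_iff.1 hw
  refine eq_zero_of_inner_fourierInv_eq_zero fun g hg => ?_
  have h : ∀ t, HasDerivAt (fun τ => inner ℂ ((evolve g hg (τ - T)).toLp 2 volume) (w τ)) 0 t :=
    fun t => by
      refine (hasDerivAt_inner_of_weak ((hasDerivAt_evolve g hg (t - T)).comp_sub_const t T)
        h1.continuousAt (h3 (evolve g hg (t - T)) t)).congr_deriv ?_
      rw [add_neg_cancel]
  have h4 := is_const_of_deriv_eq_zero (fun τ => (h τ).differentiableAt)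
    (fun τ => (h τ).deriv) T 0
  simpa [evolve_zero, h2] using h4

theorem IsMaxwellSolution.unique {u₀ : EBField} {u v : ℝ → EBField}
    (hu : IsMaxwellSolution u₀ u) (hv : IsMaxwellSolution u₀ v) : v = u := by
  rw [isMaxwellSolution_iff] at hu hv
  have h : IsMaxwellSolution 0 (v - u) := isMaxwellSolution_iff.2
    ⟨hv.1.sub hu.1, by simp [hv.2.1, hu.2.1], fun ψ t => by
      simp only [Pi.sub_apply, inner_sub_right, neg_sub]
      refine ((hv.2.2 ψ t).sub (hu.2.2 ψ t)).congr_deriv ?_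
      ring⟩
  funext t
  exact sub_eq_zero.1 (h.eq_zero t)

/-- A uniform limit of solutions is a solution. -/
theorem IsMaxwellSolution.of_tendstoUniformly {v : ℕ → EBField} {u : ℕ → ℝ → EBField}
    {u' : ℝ → EBField} (hu : ∀ n, IsMaxwellSolution (v n) (u n))
    (h : TendstoUniformly u u' atTop) : IsMaxwellSolution (u' 0) u' := by
  refine isMaxwellSolution_iff.2 ⟨h.continuous (.of_forall fun n => (hu n).continuous), rfl,
    fun ψ t => ?_⟩
  have hc : ∀ a : EBField, UniformContinuous fun b : EBField => inner ℂ a b := fun a =>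
    (innerSL ℂ a).uniformContinuous
  refine hasDerivAt_of_tendstoUniformly (l := atTop)
    (f := fun n τ => inner ℂ (ψ.toLp 2 volume) (u n τ))
    (f' := fun n τ => -inner ℂ ((schwartzMaxwell ψ).toLp 2 volume) (u n τ))
    (g' := fun τ => -inner ℂ ((schwartzMaxwell ψ).toLp 2 volume) (u' τ))
    ?_ (.of_forall fun n x => (isMaxwellSolution_iff.1 (hu n)).2.2 ψ x)
    (fun x => ((hc _).continuous.tendsto _).comp (h.tendsto_at x)) t
  exact ((hc ((schwartzMaxwell ψ).toLp 2 volume)).neg.comp_tendstoUniformly h)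

/-- For data orthogonal to `ker L` there is a solution, which is the uniform limit of solutions
in the range of `L` on band-limited functions. -/
theorem exists_isMaxwellSolution {u₀ : EBField} (hu₀ : u₀ ∈ maxwellKernelᗮ) :
    ∃ (g : ℕ → 𝓢(Space3, EBValue)) (hg : ∀ n, HasCompactSupport (g n)) (u : ℝ → EBField),
      IsMaxwellSolution u₀ u ∧
      Tendsto (fun n => (𝓕⁻ (symbolMul (g n)) : 𝓢(Space3, EBValue)).toLp 2 volume) atTop (𝓝 u₀) ∧
      ∀ t, Tendsto (fun n => (evolve (symbolMul (g n)) (hg n).symbolMul t).toLp 2 volume) atTop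
        (𝓝 (u t)) := by
  obtain ⟨f, hf, hf'⟩ := mem_closure_iff_seq_limit.1 (mem_closure_bandLimitedRange hu₀)
  choose g hg hgf using hf
  obtain rfl : (fun n => (𝓕⁻ (symbolMul (g n)) : 𝓢(Space3, EBValue)).toLp 2 volume) = f :=
    funext hgf
  -- The distance between two of these solutions never exceeds that of their data, so the Cauchy
  -- property is uniform in `t`.
  have hcauchy : UniformCauchySeqOn
      (fun n t => (evolve (symbolMul (g n)) (hg n).symbolMul t).toLp 2 volume) atTop Set.univ := by
    rw [Metric.uniformCauchySeqOn_iff]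
    intro ε hε
    obtain ⟨N, hN⟩ := Metric.cauchySeq_iff.1 hf'.cauchySeq ε hε
    refine ⟨N, fun m hm n hn t _ => lt_of_le_of_lt ?_ (hN m hm n hn)⟩
    rw [dist_eq_norm, dist_eq_norm]
    exact norm_evolve_sub_evolve _ _ _ _ t
  choose u hu using fun t => cauchySeq_tendsto_of_complete (hcauchy.cauchySeq (Set.mem_univ t))
  have hunif := tendstoUniformlyOn_univ.1
    (hcauchy.tendstoUniformlyOn_of_tendsto fun t _ => hu t)
  have hsol := IsMaxwellSolution.of_tendstoUniformly
    (fun n => isMaxwellSolution_evolve (symbolMul (g n)) (hg n).symbolMul) hunif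
  have h0 : u 0 = u₀ := by
    refine tendsto_nhds_unique (hu 0) ?_
    simpa only [evolve_zero] using hf'
  exact ⟨g, hg, u, h0 ▸ hsol, hf', hu⟩

/-! ### The Morawetz identity for real divergence-free fields -/

theorem integrable_temperate_mul_mul {w : Space3 → ℝ} (hw : w.HasTemperateGrowth)
    (a b : 𝓢(Space3, ℝ)) : Integrable fun x => w x * (a x * b x) := by
  refine (SchwartzMap.smulLeftCLM ℝ w
    (SchwartzMap.pairing (ContinuousLinearMap.mul ℝ ℝ) a b)).integrable.congr (.of_forall fun x => ?_)
  simp [SchwartzMap.smulLeftCLM_apply_apply hw, SchwartzMap.pairing_apply_apply]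

/-- Integration by parts for Schwartz functions with a weight of temperate growth. -/
theorem integral_temperate_mul_lineDeriv {w w' : Space3 → ℝ} (hw : w.HasTemperateGrowth)
    (hw' : w'.HasTemperateGrowth) {m : Space3} (hd : ∀ x, HasLineDerivAt ℝ w (w' x) x m)
    (a b : 𝓢(Space3, ℝ)) :
    Integrable (fun x => w x * ((∂_{m} a : 𝓢(Space3, ℝ)) x * b x) +
      w x * (a x * (∂_{m} b : 𝓢(Space3, ℝ)) x) + w' x * (a x * b x)) ∧
    ∫ x, (w x * ((∂_{m} a : 𝓢(Space3, ℝ)) x * b x) +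
      w x * (a x * (∂_{m} b : 𝓢(Space3, ℝ)) x) + w' x * (a x * b x)) = 0 := by
  have h1 := integrable_temperate_mul_mul hw (∂_{m} a) b
  have h2 := integrable_temperate_mul_mul hw a (∂_{m} b)
  have h3 := integrable_temperate_mul_mul hw' a b
  refine ⟨(h1.add h2).add h3, ?_⟩
  have hf : ∀ x, SchwartzMap.smulLeftCLM ℝ w a x = w x * a x := fun x => by
    simp [SchwartzMap.smulLeftCLM_apply_apply hw]
  have hdf : ∀ x, (∂_{m} (SchwartzMap.smulLeftCLM ℝ w a) : 𝓢(Space3, ℝ)) x =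
      w' x * a x + w x * (∂_{m} a : 𝓢(Space3, ℝ)) x := fun x => by
    rw [SchwartzMap.lineDerivOp_apply]
    have ha : HasLineDerivAt ℝ a ((∂_{m} a : 𝓢(Space3, ℝ)) x) x m := by
      rw [SchwartzMap.lineDerivOp_apply_eq_fderiv]
      exact (a.hasFDerivAt x).hasLineDerivAt m
    have h : HasLineDerivAt ℝ (fun y => w y * a y)
        (w' x * a x + w x * (∂_{m} a : 𝓢(Space3, ℝ)) x) x m := by
      refine HasDerivAt.congr_deriv (HasDerivAt.mul (hd x) ha) ?_
      simp
    rw [← h.lineDeriv]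
    congr 1
    ext1 y
    exact hf y
  have h4 := SchwartzMap.integral_mul_lineDerivOp_right_eq_neg_left (μ := volume)
    (SchwartzMap.smulLeftCLM ℝ w a) b m
  simp only [hf, hdf] at h4
  rw [integral_add (f := fun x => w x * ((∂_{m} a : 𝓢(Space3, ℝ)) x * b x) +
    w x * (a x * (∂_{m} b : 𝓢(Space3, ℝ)) x)) (h1.add h2) h3, integral_add h1 h2]
  have h5 : ∫ x, (w' x * a x + w x * (∂_{m} a : 𝓢(Space3, ℝ)) x) * b x =
      (∫ x, w' x * (a x * b x)) + ∫ x, w x * ((∂_{m} a : 𝓢(Space3, ℝ)) x * b x) := by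
    rw [← integral_add h3 h1]
    congr 1
    ext x
    ring
  have h6 : ∫ x, w x * (a x * (∂_{m} b : 𝓢(Space3, ℝ)) x) =
      ∫ x, w x * a x * (∂_{m} b : 𝓢(Space3, ℝ)) x := by
    congr 1
    ext x
    ring
  rw [h6, h4, h5]
  ring

/-- The profile `h` of the Morawetz vector field `X(x) = h(x) x`. -/
noncomputable def morawetzProfile (s : ℝ) (x : Space3) : ℝ :=
  2 * (1 + ‖x‖ ^ 2) ^ (-(1 / 2) : ℝ) - (1 + ‖x‖ ^ 2) ^ (-s)

/-- The derivative of `morawetzProfile` with respect to `‖x‖ ^ 2`. -/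
noncomputable def morawetzProfile' (s : ℝ) (x : Space3) : ℝ :=
  -(1 + ‖x‖ ^ 2) ^ (-(3 / 2) : ℝ) + s * (1 + ‖x‖ ^ 2) ^ (-(s + 1))

/-- The components of the Morawetz vector field. -/
noncomputable def morawetzField (s : ℝ) (i : Fin 3) (x : Space3) : ℝ := x i * morawetzProfile s x

/-- The partial derivatives of the Morawetz vector field. -/
noncomputable def morawetzField' (s : ℝ) (i j : Fin 3) (x : Space3) : ℝ :=
  (if i = j then morawetzProfile s x else 0) + 2 * (x i * x j) * morawetzProfile' s x

theorem hasTemperateGrowth_coord (i : Fin 3) :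
    (fun x : Space3 => x i).HasTemperateGrowth :=
  (EuclideanSpace.proj i : Space3 →L[ℝ] ℝ).hasTemperateGrowth

theorem hasTemperateGrowth_morawetzProfile (s : ℝ) : (morawetzProfile s).HasTemperateGrowth := by
  unfold morawetzProfile
  fun_prop

theorem hasTemperateGrowth_morawetzField (s : ℝ) (i : Fin 3) :
    (morawetzField s i).HasTemperateGrowth :=
  (hasTemperateGrowth_coord i).mul (hasTemperateGrowth_morawetzProfile s)

theorem hasTemperateGrowth_morawetzField' (s : ℝ) (i j : Fin 3) :
    (morawetzField' s i j).HasTemperateGrowth := by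
  have h1 := hasTemperateGrowth_morawetzProfile s
  have h2 : (morawetzProfile' s).HasTemperateGrowth := by
    unfold morawetzProfile'
    fun_prop
  have h3 := hasTemperateGrowth_coord
  unfold morawetzField'
  split_ifs <;> fun_prop

theorem hasLineDerivAt_one_add_norm_sq_rpow (r : ℝ) (x : Space3) (j : Fin 3) :
    HasLineDerivAt ℝ (fun y : Space3 => (1 + ‖y‖ ^ 2) ^ r)
      (2 * x j * (r * (1 + ‖x‖ ^ 2) ^ (r - 1))) x (EuclideanSpace.single j (1 : ℝ)) := by
  have h := (((hasStrictFDerivAt_norm_sq x).hasFDerivAt.const_add 1).rpow_const (p := r)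
    (Or.inl (by positivity))).hasLineDerivAt (EuclideanSpace.single j (1 : ℝ))
  have h2 : inner ℝ x (EuclideanSpace.single j (1 : ℝ)) = x j := by
    simp [EuclideanSpace.inner_single_right]
  refine HasDerivAt.congr_deriv h ?_
  simp only [smul_apply, innerSL_apply_apply, smul_eq_mul, nsmul_eq_mul]
  rw [h2]
  push_cast
  ring

theorem hasLineDerivAt_morawetzField (s : ℝ) (i j : Fin 3) (x : Space3) :
    HasLineDerivAt ℝ (morawetzField s i) (morawetzField' s i j x) x
      (EuclideanSpace.single j (1 : ℝ)) := by
  have h1 : HasLineDerivAt ℝ (morawetzProfile s) (2 * x j * morawetzProfile' s x) x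
      (EuclideanSpace.single j (1 : ℝ)) := by
    have := ((hasLineDerivAt_one_add_norm_sq_rpow (-(1 / 2)) x j).const_mul 2).sub
      (hasLineDerivAt_one_add_norm_sq_rpow (-s) x j)
    refine HasDerivAt.congr_deriv this ?_
    rw [morawetzProfile', show (-(1 / 2) - 1 : ℝ) = -(3 / 2) by norm_num,
      show -s - 1 = -(s + 1) by ring]
    ring
  have h2 := ((EuclideanSpace.proj i : Space3 →L[ℝ] ℝ).hasFDerivAt (x := x)).hasLineDerivAt
    (EuclideanSpace.single j (1 : ℝ))
  refine HasDerivAt.congr_deriv (HasDerivAt.mul h2 h1) ?_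
  simp [morawetzField']
  ring

/-- With `d j i = ∂_j w_i`, the first sum is `X · (curl w × w)`, and the second subtracts the
divergence of `(X·w) w - |w|² X / 2`. What remains is `|w|² div X / 2 - ∑ ∂_j X_i w_i w_j`, because
the term `(X·w) div w` drops out by `hd`. -/
theorem sum_morawetzField_sub_divergence (s : ℝ) (x : Space3) (w : Fin 3 → ℝ)
    (d : Fin 3 → Fin 3 → ℝ) (hd : ∑ j, d j j = 0) :
    ∑ i, ∑ j, morawetzField s i x * (d j i * w j - d i j * w j) -
      ∑ i, ∑ j, ((morawetzField s i x * (d j i * w j) + morawetzField s i x * (w i * d j j) +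
        morawetzField' s i j x * (w i * w j)) -
        1 / 2 * (morawetzField s j x * (d j i * w i) + morawetzField s j x * (w i * d j i) +
        morawetzField' s j j x * (w i * w i))) =
    (morawetzProfile s x / 2 + (∑ i, x i ^ 2) * morawetzProfile' s x) * ∑ i, w i ^ 2 -
      2 * morawetzProfile' s x * (∑ i, x i * w i) ^ 2 := by
  simp only [Fin.sum_univ_three, morawetzField, morawetzField'] at hd ⊢
  simp +decide only [↓reduceIte]
  linear_combination
    (-(morawetzProfile s x * (x 0 * w 0 + x 1 * w 1 + x 2 * w 2))) * hd

/-- With `P = 1 + |x|²`, the part `-P^(-s)` of the profile contributes `(s - 1/2) P^(-s) - s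
P^(-s-1)`, and the part `2 P^(-1/2)` contributes exactly `P^(-3/2)`. The latter absorbs the loss
since `1/2 < s ≤ 1`; the same comparison gives the sign of the derivative. -/
theorem le_morawetzProfile {s : ℝ} (h1 : 1 / 2 < s) (h2 : s ≤ 1) (x : Space3) :
    morawetzProfile' s x ≤ 0 ∧ (s - 1 / 2) * (1 + ‖x‖ ^ 2) ^ (-s) ≤
      morawetzProfile s x / 2 + ‖x‖ ^ 2 * morawetzProfile' s x := by
  set P : ℝ := 1 + ‖x‖ ^ 2 with hP
  have hP1 : 1 ≤ P := by nlinarith [sq_nonneg ‖x‖]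
  have hP0 : 0 < P := by linarith
  set a := P ^ (-(3 / 2) : ℝ) with ha
  set b := P ^ (-(s + 1)) with hb
  have ha' : P ^ (-(1 / 2) : ℝ) = P * a := by
    rw [ha, ← Real.rpow_one_add' hP0.le (by norm_num)]
    norm_num
  have hb' : P ^ (-s) = P * b := by
    rw [hb, ← Real.rpow_one_add' hP0.le (by linarith)]
    ring_nf
  have hba : b ≤ a := Real.rpow_le_rpow_of_exponent_le hP1 (by linarith)
  have hb0 : 0 < b := Real.rpow_pos_of_pos hP0 _
  have hh : morawetzProfile s x = 2 * (P * a) - P * b := by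
    rw [morawetzProfile, ← hP, ha', hb']
  have hk : morawetzProfile' s x = -a + s * b := rfl
  rw [hb', hh, hk, show ‖x‖ ^ 2 = P - 1 by rw [hP]; ring]
  constructor <;> nlinarith

theorem morawetz_pointwise {s : ℝ} (h1 : 1 / 2 < s) (h2 : s ≤ 1) (x : Space3) (w : Fin 3 → ℝ)
    (d : Fin 3 → Fin 3 → ℝ) (hd : ∑ j, d j j = 0) :
    (s - 1 / 2) * ((1 + ‖x‖ ^ 2) ^ (-s) * ∑ i, w i ^ 2) ≤
      ∑ i, ∑ j, morawetzField s i x * (d j i * w j - d i j * w j) -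
      ∑ i, ∑ j, ((morawetzField s i x * (d j i * w j) + morawetzField s i x * (w i * d j j) +
        morawetzField' s i j x * (w i * w j)) -
        1 / 2 * (morawetzField s j x * (d j i * w i) + morawetzField s j x * (w i * d j i) +
        morawetzField' s j j x * (w i * w i))) := by
  obtain ⟨hk, hr⟩ := le_morawetzProfile h1 h2 x
  rw [sum_morawetzField_sub_divergence s x w d hd, ← mul_assoc,
    show ∑ i, x i ^ 2 = ‖x‖ ^ 2 by simp [EuclideanSpace.norm_sq_eq]]
  have hw : 0 ≤ ∑ i, w i ^ 2 := by positivity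
  linarith [mul_le_mul_of_nonneg_right hr hw, mul_nonneg (neg_nonneg.2 hk)
    (sq_nonneg (∑ i, x i * w i))]

/-- The Morawetz estimate for a divergence-free real vector field. -/
theorem morawetz_real {s : ℝ} (h1 : 1 / 2 < s) (h2 : s ≤ 1) (w : Fin 3 → 𝓢(Space3, ℝ))
    (d : Fin 3 → Fin 3 → 𝓢(Space3, ℝ)) (hd : ∀ j i, d j i = ∂_{EuclideanSpace.single j (1 : ℝ)} (w i))
    (hdiv : ∀ x, ∑ j, d j j x = 0) :
    Integrable (fun x => ∑ i, ∑ j, morawetzField s i x * (d j i x * w j x - d i j x * w j x)) ∧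
    Integrable (fun x : Space3 => (1 + ‖x‖ ^ 2) ^ (-s) * ∑ i, w i x ^ 2) ∧
    (s - 1 / 2) * ∫ x : Space3, (1 + ‖x‖ ^ 2) ^ (-s) * ∑ i, w i x ^ 2 ≤
      ∫ x, ∑ i, ∑ j, morawetzField s i x * (d j i x * w j x - d i j x * w j x) := by
  have hX := hasTemperateGrowth_morawetzField s
  have hX' := hasTemperateGrowth_morawetzField' s
  have hL : Integrable fun x => ∑ i, ∑ j,
      morawetzField s i x * (d j i x * w j x - d i j x * w j x) :=
    integrable_finsetSum _ fun i _ => integrable_finsetSum _ fun j _ => by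
      simp only [mul_sub]
      exact (integrable_temperate_mul_mul (hX i) _ _).sub (integrable_temperate_mul_mul (hX i) _ _)
  have hW : Integrable fun x : Space3 => (1 + ‖x‖ ^ 2) ^ (-s) * ∑ i, w i x ^ 2 := by
    simp only [Finset.mul_sum, sq (w _ _)]
    exact integrable_finsetSum _ fun i _ => integrable_temperate_mul_mul (by fun_prop) _ _
  refine ⟨hL, hW, ?_⟩
  have hZ := fun (i j k l : Fin 3) =>
    integral_temperate_mul_lineDeriv (hX i) (hX' i j) (hasLineDerivAt_morawetzField s i j) (w k) (w l)
  simp only [← hd] at hZ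
  -- `Z i j k l` is `∂_j (X_i w_k w_l)` written out, so its integral is zero. Subtracting such terms
  -- leaves the integral unchanged and makes the pointwise inequality available.
  obtain ⟨Z, hZd⟩ : ∃ Z : Fin 3 → Fin 3 → Fin 3 → Fin 3 → Space3 → ℝ, ∀ i j k l, Z i j k l =
      fun x => morawetzField s i x * (d j k x * w l x) + morawetzField s i x * (w k x * d j l x) +
        morawetzField' s i j x * (w k x * w l x) := ⟨_, fun _ _ _ _ => rfl⟩
  simp only [← hZd] at hZ
  have hZi : ∀ i j, Integrable fun x => Z i j i j x - 1 / 2 * Z j j i i x := fun i j =>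
    (hZ i j i j).1.sub ((hZ j j i i).1.const_mul (1 / 2))
  have hZs : ∀ i, Integrable fun x => ∑ j, (Z i j i j x - 1 / 2 * Z j j i i x) := fun i =>
    integrable_finsetSum _ fun j _ => hZi i j
  have hZ0 : ∫ x, ∑ i, ∑ j, (Z i j i j x - 1 / 2 * Z j j i i x) = 0 := by
    rw [integral_finsetSum _ fun i _ => hZs i]
    refine Finset.sum_eq_zero fun i _ => ?_
    rw [integral_finsetSum _ fun j _ => hZi i j]
    refine Finset.sum_eq_zero fun j _ => ?_
    rw [integral_sub (hZ i j i j).1 ((hZ j j i i).1.const_mul (1 / 2)), (hZ i j i j).2,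
      integral_const_mul, (hZ j j i i).2]
    simp
  rw [← integral_const_mul, ← sub_zero (∫ x, ∑ i, ∑ j, _ : ℝ), ← hZ0,
    ← integral_sub hL (integrable_finsetSum _ fun i _ => hZs i)]
  refine integral_mono (hW.const_mul _) (hL.sub (integrable_finsetSum _ fun i _ => hZs i))
    fun x => ?_
  simp only [hZd]
  exact morawetz_pointwise h1 h2 x (fun i => w i x) (fun j i => d j i x) (hdiv x)

/-! ### The Morawetz estimate for the Maxwell system -/

/-- The range of `L` consists of fields whose electric and magnetic parts are divergence-free. -/
theorem divergence_schwartzMaxwell (χ : 𝓢(Space3, EBValue)) (x : Space3) :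
    ∑ j, (∂_{EuclideanSpace.single j (1 : ℝ)} (schwartzMaxwell χ) : 𝓢(Space3, EBValue)) x
        (Sum.inl j) = 0 ∧
    ∑ j, (∂_{EuclideanSpace.single j (1 : ℝ)} (schwartzMaxwell χ) : 𝓢(Space3, EBValue)) x
        (Sum.inr j) = 0 := by
  -- Here `c` selects the electric or the magnetic rows. On the Fourier side the divergence is a
  -- multiple of `ξ · (ξ × v)`, hence zero.
  have h : ∀ c : Fin 3 → EBIndex,
      (∀ (ξ : Space3) v, ∑ j, (ξ j : ℂ) * maxwellSymbol ξ v (c j) = 0) →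
      ∑ j, (∂_{EuclideanSpace.single j (1 : ℝ)} (schwartzMaxwell χ) : 𝓢(Space3, EBValue)) x
        (c j) = 0 := fun c hc => by
    have h1 : ∑ j, SchwartzMap.postcompCLM (EuclideanSpace.proj (c j) : EBValue →L[ℂ] ℂ)
        (∂_{EuclideanSpace.single j (1 : ℝ)} (schwartzMaxwell χ)) = 0 := by
      rw [← (FourierTransform.fourierInv_fourier_eq χ : 𝓕⁻ (𝓕 χ : 𝓢(Space3, EBValue)) = χ),
        schwartzMaxwell_fourierInv]
      simp only [SchwartzMap.lineDerivOp_fourierInv_eq, postcompCLM_fourierInv]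
      rw [← FourierTransform.fourierInv_sum]
      refine Eq.trans (congrArg (fun g : 𝓢(Space3, ℂ) => (𝓕⁻ g : 𝓢(Space3, ℂ))) ?_)
        (FourierTransform.fourierInv_zero (E := 𝓢(Space3, ℂ)))
      ext1 ξ
      have h2 : ∀ j, SchwartzMap.smulLeftCLM EBValue
          (fun ξ : Space3 => inner ℝ ξ (EuclideanSpace.single j (1 : ℝ))) (symbolMul (𝓕 χ)) ξ =
          (ξ j) • symbolMul (𝓕 χ) ξ := fun j => by
        rw [SchwartzMap.smulLeftCLM_apply_apply (by fun_prop)]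
        congr 1
        simp [EuclideanSpace.inner_single_right]
      simp only [sum_apply, SchwartzMap.postcompCLM_apply, smul_apply, h2, symbolMul_apply, map_smul]
      have h3 := congrArg (fun z => (2 * Real.pi * Complex.I) * z) (hc ξ ((𝓕 χ : 𝓢(Space3, EBValue)) ξ))
      simpa [Finset.mul_sum] using h3
    simpa [sum_apply] using DFunLike.congr_fun h1 x
  constructor <;> refine h _ fun ξ v => ?_ <;>
    simp [maxwellSymbol, maxwellCoeff_apply, crossProduct, Fin.sum_univ_three] <;> ring

/-- Multiplication of a Schwartz function by `∑ j, X_j A_j`, for the Morawetz field `X`. -/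
noncomputable def morawetzMul (s : ℝ) : 𝓢(Space3, EBValue) →L[ℂ] 𝓢(Space3, EBValue) :=
  ∑ j : Fin 3, SchwartzMap.postcompCLM (maxwellCoeff j) ∘L
    SchwartzMap.smulLeftCLM EBValue fun x : Space3 => ((morawetzField s j x : ℝ) : ℂ)

theorem morawetzMul_apply (s : ℝ) (ψ : 𝓢(Space3, EBValue)) (x : Space3) :
    morawetzMul s ψ x = ∑ j, (morawetzField s j x : ℂ) • maxwellCoeff j (ψ x) := by
  have h : ∀ j : Fin 3, (fun x : Space3 => ((morawetzField s j x : ℝ) : ℂ)).HasTemperateGrowth :=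
    fun j => by
      have := hasTemperateGrowth_morawetzField s j
      fun_prop
  have h2 := fun j => SchwartzMap.smulLeftCLM_apply_apply (F := EBValue) (h j) ψ x
  simp only [morawetzMul, sum_apply, ContinuousLinearMap.comp_apply,
    SchwartzMap.postcompCLM_apply, h2, map_smul]

theorem inner_morawetzMul_left (s : ℝ) (ψ χ : 𝓢(Space3, EBValue)) :
    inner ℂ ((morawetzMul s ψ).toLp 2 volume) (χ.toLp 2 volume) =
      inner ℂ (ψ.toLp 2 volume) ((morawetzMul s χ).toLp 2 volume) := by
  rw [inner_toLp_toLp, inner_toLp_toLp]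
  congr 1
  ext x
  simp only [morawetzMul_apply, sum_inner, inner_sum, inner_smul_left, inner_smul_right,
    inner_maxwellCoeff_left, Complex.conj_ofReal]

/-- For `s > 1/2` the profile lies between `0` and `2(1+|x|²)^(-1/2)`, which compensates the growth
of `x i`. -/
theorem abs_morawetzField_le {s : ℝ} (h1 : 1 / 2 < s) (i : Fin 3) (x : Space3) :
    |morawetzField s i x| ≤ 2 := by
  have hP1 : 1 ≤ 1 + ‖x‖ ^ 2 := by nlinarith [sq_nonneg ‖x‖]
  have hP0 : 0 < 1 + ‖x‖ ^ 2 := by linarith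
  have h3 : (1 + ‖x‖ ^ 2) ^ (-s) ≤ (1 + ‖x‖ ^ 2) ^ (-(1 / 2) : ℝ) :=
    Real.rpow_le_rpow_of_exponent_le hP1 (by linarith)
  have h4 : 0 < (1 + ‖x‖ ^ 2) ^ (-s) := Real.rpow_pos_of_pos hP0 _
  have h5 : |morawetzProfile s x| ≤ 2 * (1 + ‖x‖ ^ 2) ^ (-(1 / 2) : ℝ) := by
    rw [morawetzProfile, abs_of_nonneg] <;> linarith
  have h6 : |x i| ≤ √(1 + ‖x‖ ^ 2) := by
    refine (PiLp.norm_apply_le x i).trans (Real.le_sqrt_of_sq_le ?_)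
    linarith
  rw [morawetzField, abs_mul]
  calc |x i| * |morawetzProfile s x| ≤ √(1 + ‖x‖ ^ 2) * (2 * (1 + ‖x‖ ^ 2) ^ (-(1 / 2) : ℝ)) := by
        gcongr
    _ = 2 := by
      rw [Real.sqrt_eq_rpow, mul_left_comm, ← Real.rpow_add hP0]
      norm_num

theorem norm_morawetzMul_le {s : ℝ} (h1 : 1 / 2 < s) (ψ : 𝓢(Space3, EBValue)) :
    ‖(morawetzMul s ψ).toLp 2 volume‖ ≤ (∑ j, 2 * ‖maxwellCoeff j‖) * ‖ψ.toLp 2 volume‖ := by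
  refine norm_toLp_le_of_norm_le fun x => ?_
  rw [morawetzMul_apply, Finset.sum_mul]
  refine norm_sum_le_of_le _ fun j _ => ?_
  rw [norm_smul, Complex.norm_real, Real.norm_eq_abs, mul_assoc]
  exact mul_le_mul (abs_morawetzField_le h1 j x) ((maxwellCoeff j).le_opNorm _) (norm_nonneg _)
    two_pos.le

/-- The real and imaginary parts of the electric and magnetic field. -/
noncomputable def ebRealPart (c : Fin 2 × Fin 2) (i : Fin 3) : EBValue →L[ℝ] ℝ :=
  (if c.2 = 0 then Complex.reCLM else Complex.imCLM) ∘L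
    (EuclideanSpace.proj (if c.1 = 0 then Sum.inl i else Sum.inr i) : EBValue →L[ℂ] ℂ).restrictScalars ℝ

theorem sum_ebRealPart_sq (v : EBValue) : ∑ c, ∑ i, ebRealPart c i v ^ 2 = ‖v‖ ^ 2 := by
  rw [EuclideanSpace.norm_sq_eq]
  simp [Fintype.sum_prod_type, ebRealPart, Fin.sum_univ_three, ← Complex.normSq_eq_norm_sq,
    Complex.normSq_apply]
  ring

/-- Pointwise algebra: `-curl w · (X × w) = X · (curl w × w)`, summed over the real and imaginary
parts of `E` and `B`. This reduces the system to real vector fields. -/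
theorem neg_re_inner_eq_sum_ebRealPart (X : Fin 3 → ℝ) (d : Fin 3 → EBValue) (v : EBValue) :
    -(inner ℂ (∑ j, maxwellCoeff j (d j)) (∑ j, (X j : ℂ) • maxwellCoeff j v)).re =
      ∑ c, ∑ i, ∑ j, X i * (ebRealPart c i (d j) * ebRealPart c j v -
        ebRealPart c j (d i) * ebRealPart c j v) := by
  simp [Fintype.sum_prod_type, ebRealPart, Fin.sum_univ_three, maxwellCoeff_apply, crossProduct,
    PiLp.inner_apply]
  ring

/-- The Morawetz estimate for divergence-free electric and magnetic fields. -/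
theorem morawetz_schwartz {s : ℝ} (h1 : 1 / 2 < s) (h2 : s ≤ 1) (ψ : 𝓢(Space3, EBValue))
    (hE : ∀ x, ∑ j, (∂_{EuclideanSpace.single j (1 : ℝ)} ψ : 𝓢(Space3, EBValue)) x (Sum.inl j) = 0)
    (hB : ∀ x, ∑ j, (∂_{EuclideanSpace.single j (1 : ℝ)} ψ : 𝓢(Space3, EBValue)) x (Sum.inr j) = 0) :
    (s - 1 / 2) * ∫ x : Space3, (1 + ‖x‖ ^ 2) ^ (-s) * ‖ψ x‖ ^ 2 ≤
      -(inner ℂ ((schwartzMaxwell ψ).toLp 2 volume) ((morawetzMul s ψ).toLp 2 volume)).re := by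
  have h := fun c => morawetz_real h1 h2 (fun i => SchwartzMap.postcompCLM (ebRealPart c i) ψ)
    (fun j i => SchwartzMap.postcompCLM (ebRealPart c i) (∂_{EuclideanSpace.single j (1 : ℝ)} ψ))
    (fun j i => (lineDerivOp_postcompCLM _ _ _).symm) (fun x => by
      obtain ⟨a, b⟩ := c
      have hE' := hE x
      have hB' := hB x
      simp only [Fin.sum_univ_three] at hE' hB' ⊢
      simp only [SchwartzMap.postcompCLM_apply]
      have e1 := congrArg Complex.re hE'
      have e2 := congrArg Complex.im hE'
      have e3 := congrArg Complex.re hB'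
      have e4 := congrArg Complex.im hB'
      fin_cases a <;> fin_cases b
      · simpa [ebRealPart] using e1
      · simpa [ebRealPart] using e2
      · simpa [ebRealPart] using e3
      · simpa [ebRealPart] using e4)
  simp only [SchwartzMap.postcompCLM_apply] at h
  rw [inner_toLp_toLp, ← Complex.reCLM_apply, ← ContinuousLinearMap.integral_comp_comm,
    ← integral_neg]
  · simp only [Complex.reCLM_apply, schwartzMaxwell_apply, morawetzMul_apply,
      neg_re_inner_eq_sum_ebRealPart, ← sum_ebRealPart_sq, Finset.mul_sum (Finset.univ : Finset (Fin 2 × Fin 2))]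
    rw [integral_finsetSum _ fun c _ => (h c).2.1, integral_finsetSum _ fun c _ => (h c).1,
      Finset.mul_sum]
    exact Finset.sum_le_sum fun c _ => (h c).2.2
  · refine (integrable_inner_schwartz (schwartzMaxwell ψ) ((morawetzMul s ψ).toLp 2 volume)).congr ?_
    filter_upwards [(morawetzMul s ψ).coeFn_toLp 2] with x hx
    rw [hx]

/-! ### Integration in time and passage to the limit -/

/-- Multiplication by the weight `(1 + |x|²) ^ (-s / 2)` is a bounded operator on `L²`. -/
theorem exists_weightMul {s : ℝ} (hs : 0 ≤ s) : ∃ S : EBField →L[ℝ] EBField, ∀ f : EBField,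
    S f =ᵐ[volume] fun x => ((1 + ‖x‖ ^ 2) ^ (-s / 2) : ℝ) • f x := by
  have hc : Continuous fun x : Space3 => ((1 + ‖x‖ ^ 2) ^ (-s / 2) : ℝ) :=
    (Function.hasTemperateGrowth_one_add_norm_sq_rpow Space3 (-s / 2)).1.continuous
  have hm : MemLp (fun x : Space3 => ((1 + ‖x‖ ^ 2) ^ (-s / 2) : ℝ)) ∞ volume := by
    refine memLp_top_of_bound hc.aestronglyMeasurable 1 (.of_forall fun x => ?_)
    rw [Real.norm_of_nonneg (by positivity)]
    exact Real.rpow_le_one_of_one_le_of_nonpos (by nlinarith [sq_nonneg ‖x‖]) (by linarith)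
  refine ⟨(ContinuousLinearMap.lsmul ℝ ℝ : ℝ →L[ℝ] EBValue →L[ℝ] EBValue).holderL volume ∞ 2 2
    hm.toLp, fun f => ?_⟩
  refine (ContinuousLinearMap.coeFn_holder _ _ _).trans ?_
  filter_upwards [hm.coeFn_toLp] with x hx
  rw [hx]
  rfl

theorem norm_weightMul_sq {s : ℝ} {S : EBField →L[ℝ] EBField} (hS : ∀ f : EBField,
    S f =ᵐ[volume] fun x => ((1 + ‖x‖ ^ 2) ^ (-s / 2) : ℝ) • f x) (f : EBField) :
    Integrable (fun x => (1 + ‖x‖ ^ 2) ^ (-s) * ‖f x‖ ^ 2) ∧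
    ‖S f‖ ^ 2 = ∫ x, (1 + ‖x‖ ^ 2) ^ (-s) * ‖f x‖ ^ 2 := by
  have h : (fun x => (inner ℂ (S f x) (S f x)).re) =ᵐ[volume]
      fun x => (1 + ‖x‖ ^ 2) ^ (-s) * ‖f x‖ ^ 2 := by
    filter_upwards [hS f] with x hx
    have hP : 0 < 1 + ‖x‖ ^ 2 := by positivity
    rw [hx, ← RCLike.re_eq_complex_re, inner_self_eq_norm_sq, norm_smul,
      Real.norm_of_nonneg (by positivity), mul_pow, sq ((1 + ‖x‖ ^ 2) ^ (-s / 2)),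
      ← Real.rpow_add hP]
    ring_nf
  have hi : Integrable fun x => inner ℂ (S f x) (S f x) := L2.integrable_inner (S f) (S f)
  refine ⟨hi.re.congr h, ?_⟩
  rw [← integral_congr_ae h, ← inner_self_eq_norm_sq (𝕜 := ℂ), L2.inner_def]
  exact (integral_re hi).symm

theorem lintegral_weight {s : ℝ} {S : EBField →L[ℝ] EBField} (hS : ∀ f : EBField,
    S f =ᵐ[volume] fun x => ((1 + ‖x‖ ^ 2) ^ (-s / 2) : ℝ) • f x) (f : EBField) :
    ∫⁻ x, ENNReal.ofReal ((1 + ‖x‖ ^ 2) ^ (-s) * ‖f x‖ ^ 2) = ENNReal.ofReal (‖S f‖ ^ 2) := by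
  obtain ⟨h1, h2⟩ := norm_weightMul_sq hS f
  rw [h2, ofReal_integral_eq_lintegral_ofReal h1 (.of_forall fun x => by positivity)]

/-- The multiplier `∑ X_j A_j` is bounded and symmetric, so both terms of the product rule have the
same real part. -/
theorem hasDerivAt_inner_morawetzMul {s : ℝ} (h1 : 1 / 2 < s) (g : 𝓢(Space3, EBValue))
    (hg : HasCompactSupport g) (t : ℝ) :
    HasDerivAt (fun τ => (inner ℂ ((evolve g hg τ).toLp 2 volume)
        ((morawetzMul s (evolve g hg τ)).toLp 2 volume)).re)
      (2 * (inner ℂ ((schwartzMaxwell (evolve g hg t)).toLp 2 volume)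
        ((morawetzMul s (evolve g hg t)).toLp 2 volume)).re) t := by
  have hu := hasDerivAt_evolve g hg
  have hc : Continuous fun τ => (morawetzMul s (evolve g hg τ)).toLp 2 volume := by
    refine continuous_iff_continuousAt.2 fun t => ?_
    rw [ContinuousAt, tendsto_iff_norm_sub_tendsto_zero]
    have h0 := (tendsto_iff_norm_sub_tendsto_zero.1 (hu t).continuousAt.tendsto).const_mul
      (∑ j, 2 * ‖maxwellCoeff j‖)
    rw [mul_zero] at h0
    refine squeeze_zero (fun _ => norm_nonneg _) (fun τ => ?_) h0
    have := norm_morawetzMul_le h1 (evolve g hg τ - evolve g hg t)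
    simpa only [← SchwartzMap.toLpCLM_apply (𝕜 := ℂ), map_sub] using this
  have hw : HasDerivAt (fun τ => inner ℂ ((evolve g hg t).toLp 2 volume)
      ((morawetzMul s (evolve g hg τ)).toLp 2 volume))
      (inner ℂ ((morawetzMul s (evolve g hg t)).toLp 2 volume)
        ((schwartzMaxwell (evolve g hg t)).toLp 2 volume)) t := by
    simp only [← inner_morawetzMul_left]
    refine ((hasDerivAt_const t _).inner ℂ (hu t)).congr_deriv ?_
    rw [inner_zero_left, add_zero]
  have h := hasDerivAt_inner_of_weak (hu t) hc.continuousAt hw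
  refine (Complex.reCLM.hasFDerivAt.comp_hasDerivAt t h).congr_deriv ?_
  rw [← inner_conj_symm ((morawetzMul s (evolve g hg t)).toLp 2 volume)]
  simp
  ring

theorem lintegral_le_of_intervalIntegral_le {N : ℝ → ℝ} (hN : Continuous N) (h0 : ∀ t, 0 ≤ N t)
    {C : ℝ} (h : ∀ T : ℝ, 0 ≤ T → ∫ t in (-T)..T, N t ≤ C) :
    ∫⁻ t, ENNReal.ofReal (N t) ≤ ENNReal.ofReal C := by
  have hcov : AECover (volume : Measure ℝ) atTop fun n : ℕ => Set.Ioc (-(n : ℝ)) n :=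
    aecover_Ioc (tendsto_neg_atTop_atBot.comp tendsto_natCast_atTop_atTop)
      tendsto_natCast_atTop_atTop
  refine le_of_tendsto' (hcov.lintegral_tendsto_of_countably_generated
    (ENNReal.continuous_ofReal.comp hN).measurable.aemeasurable) fun n => ?_
  have hn : (0 : ℝ) ≤ n := n.cast_nonneg
  change ∫⁻ t in Set.Ioc (-(n : ℝ)) n, ENNReal.ofReal (N t) ≤ _
  rw [← ofReal_integral_eq_lintegral_ofReal (hN.integrableOn_Ioc) (.of_forall h0),
    ← intervalIntegral.integral_of_le (by linarith)]
  exact ENNReal.ofReal_le_ofReal (h n hn)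

/-- The local smoothing estimate for solutions with smooth band-limited data. -/
theorem lintegral_evolve_le {s : ℝ} (h1 : 1 / 2 < s) (h2 : s ≤ 1) {S : EBField →L[ℝ] EBField}
    (hS : ∀ f : EBField, S f =ᵐ[volume] fun x => ((1 + ‖x‖ ^ 2) ^ (-s / 2) : ℝ) • f x)
    (g : 𝓢(Space3, EBValue)) (hg : HasCompactSupport g) :
    ∫⁻ t, ENNReal.ofReal (‖S ((evolve (symbolMul g) hg.symbolMul t).toLp 2 volume)‖ ^ 2) ≤
      ENNReal.ofReal ((∑ j, 2 * ‖maxwellCoeff j‖) / (s - 1 / 2) *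
        ‖(𝓕⁻ (symbolMul g) : 𝓢(Space3, EBValue)).toLp 2 volume‖ ^ 2) := by
  set M := ∑ j, 2 * ‖maxwellCoeff j‖ with hM
  set u := evolve (symbolMul g) hg.symbolMul with hu
  set R := ‖(𝓕⁻ (symbolMul g) : 𝓢(Space3, EBValue)).toLp 2 volume‖ with hR
  have hM0 : 0 ≤ M := Finset.sum_nonneg fun j _ => by positivity
  have hs : 0 < s - 1 / 2 := by linarith
  have hcont : Continuous fun t => (u t).toLp 2 volume :=
    (isMaxwellSolution_evolve (symbolMul g) hg.symbolMul).continuous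
  have hN : Continuous fun t => ‖S ((u t).toLp 2 volume)‖ ^ 2 := by fun_prop
  refine lintegral_le_of_intervalIntegral_le hN (fun t => by positivity) fun T hT => ?_
  set q : ℝ → ℝ := fun t =>
    (inner ℂ ((u t).toLp 2 volume) ((morawetzMul s (u t)).toLp 2 volume)).re with hq
  have hqd := hasDerivAt_inner_morawetzMul h1 (symbolMul g) hg.symbolMul
  have hqb : ∀ t, |q t| ≤ M * R ^ 2 := fun t => by
    have h3 : ‖(u t).toLp 2 volume‖ ≤ R := norm_evolve (symbolMul g) hg.symbolMul t
    calc |q t| ≤ ‖(u t).toLp 2 volume‖ * ‖(morawetzMul s (u t)).toLp 2 volume‖ :=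
          (Complex.abs_re_le_norm _).trans (norm_inner_le_norm _ _)
      _ ≤ R * (M * R) := by
          gcongr
          exact (norm_morawetzMul_le h1 _).trans (by gcongr)
      _ = M * R ^ 2 := by ring
  have hmor : ∀ t, 2 * (s - 1 / 2) * ‖S ((u t).toLp 2 volume)‖ ^ 2 ≤
      -(2 * (inner ℂ ((schwartzMaxwell (u t)).toLp 2 volume)
        ((morawetzMul s (u t)).toLp 2 volume)).re) := fun t => by
    -- `u t` is `M` applied to the evolution of `g`, hence divergence-free in both parts.
    have hdiv := divergence_schwartzMaxwell (evolve g hg t)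
    rw [← evolve_symbolMul, ← hu] at hdiv
    have h3 := morawetz_schwartz h1 h2 (u t) (fun x => (hdiv x).1) fun x => (hdiv x).2
    have h4 : ∫ x, (1 + ‖x‖ ^ 2) ^ (-s) * ‖(u t).toLp 2 volume x‖ ^ 2 =
        ∫ x, (1 + ‖x‖ ^ 2) ^ (-s) * ‖u t x‖ ^ 2 := by
      apply integral_congr_ae
      filter_upwards [(u t).coeFn_toLp 2] with x hx
      rw [hx]
    rw [(norm_weightMul_sq hS _).2, h4]
    linarith
  -- Since `-q` grows at least as fast as the weighted energy, the time integral is at most `q(-T) -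
  -- q(T) ≤ 2MR²`, independently of `T`.
  have h5 := intervalIntegral.integral_le_sub_of_hasDeriv_right_of_le (a := -T) (b := T)
    (g := fun t => -q t) (φ := fun t => 2 * (s - 1 / 2) * ‖S ((u t).toLp 2 volume)‖ ^ 2)
    (by linarith)
    (fun t _ => (hqd t).neg.continuousAt.continuousWithinAt)
    (fun t _ => (hqd t).neg.hasDerivWithinAt)
    ((continuous_const.mul hN).integrableOn_Icc) (fun t _ => hmor t)
  rw [intervalIntegral.integral_const_mul] at h5
  have h6 := abs_le.1 (hqb T)
  have h7 := abs_le.1 (hqb (-T))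
  rw [div_mul_eq_mul_div, le_div_iff₀ hs]
  linarith [h6.1, h7.2]

theorem lintegral_solution_le {s : ℝ} (h1 : 1 / 2 < s) (h2 : s ≤ 1) {u₀ : EBField}
    {g : ℕ → 𝓢(Space3, EBValue)} (hg : ∀ n, HasCompactSupport (g n)) {u : ℝ → EBField}
    (hu₀ : Tendsto (fun n => (𝓕⁻ (symbolMul (g n)) : 𝓢(Space3, EBValue)).toLp 2 volume) atTop
      (𝓝 u₀))
    (hu : ∀ t, Tendsto (fun n => (evolve (symbolMul (g n)) (hg n).symbolMul t).toLp 2 volume) atTop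
        (𝓝 (u t))) :
    ∫⁻ t : ℝ, ∫⁻ x : Space3, ENNReal.ofReal ((1 + ‖x‖ ^ 2) ^ (-s) * ‖u t x‖ ^ 2) ≤
      ENNReal.ofReal ((∑ j, 2 * ‖maxwellCoeff j‖) / (s - 1 / 2) * ‖u₀‖ ^ 2) := by
  obtain ⟨S, hS⟩ := exists_weightMul (s := s) (by linarith)
  simp only [lintegral_weight hS]
  have hc : Continuous fun f : EBField => ENNReal.ofReal (‖S f‖ ^ 2) :=
    ENNReal.continuous_ofReal.comp (by fun_prop)
  -- Convergence at each fixed time is enough: the weighted norm is continuous on `L²`, and Fatou's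
  -- lemma handles the time integral.
  have h3 : ∀ t, liminf (fun n => ENNReal.ofReal
      (‖S ((evolve (symbolMul (g n)) (hg n).symbolMul t).toLp 2 volume)‖ ^ 2)) atTop =
      ENNReal.ofReal (‖S (u t)‖ ^ 2) := fun t =>
    ((hc.tendsto _).comp (hu t)).liminf_eq
  simp only [← h3]
  refine (lintegral_liminf_le fun n => ?_).trans ?_
  · exact (hc.comp (isMaxwellSolution_evolve (symbolMul (g n)) (hg n).symbolMul).continuous).measurable
  · refine (liminf_le_liminf (.of_forall fun n => lintegral_evolve_le h1 h2 hS (g n) (hg n))).trans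
      (le_of_eq ?_)
    exact Tendsto.liminf_eq (ENNReal.tendsto_ofReal ((hu₀.norm.pow 2).const_mul _))

theorem mainTheorem10 (s : ℝ) (hs : 1 / 2 < s) :
    ∃ C : ℝ, 0 < C ∧ ∀ u₀ ∈ maxwellKernelᗮ,
      ∃ u : ℝ → EBField, IsMaxwellSolution u₀ u ∧
        (∀ v : ℝ → EBField, IsMaxwellSolution u₀ v → v = u) ∧
        ∫⁻ t : ℝ, ∫⁻ x : Space3, ENNReal.ofReal ((1 + ‖x‖ ^ 2) ^ (-s) * ‖u t x‖ ^ 2)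
          ≤ ENNReal.ofReal (C * ‖u₀‖ ^ 2) := by
  -- The multiplier needs `s ≤ 1`. For larger `s` the weight is smaller than the one for exponent
  -- `1`.
  set r := min s 1 with hr
  have h1 : 1 / 2 < r := lt_min hs (by norm_num)
  set K := (∑ j, 2 * ‖maxwellCoeff j‖) / (r - 1 / 2) with hK
  have hK0 : 0 ≤ K := div_nonneg (Finset.sum_nonneg fun j _ => by positivity) (by linarith)
  -- The summand `1` makes positivity immediate from `0 ≤ K`.
  refine ⟨K + 1, by linarith, fun u₀ hu₀ => ?_⟩
  obtain ⟨g, hg, u, hsol, hlim, hu⟩ := exists_isMaxwellSolution hu₀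
  refine ⟨u, hsol, fun v hv => hsol.unique hv, ?_⟩
  calc _ ≤ ∫⁻ t : ℝ, ∫⁻ x : Space3, ENNReal.ofReal ((1 + ‖x‖ ^ 2) ^ (-r) * ‖u t x‖ ^ 2) := by
        gcongr
        · nlinarith [sq_nonneg ‖‹Space3›‖]
        · exact min_le_left _ _
    _ ≤ ENNReal.ofReal (K * ‖u₀‖ ^ 2) :=
        lintegral_solution_le h1 (min_le_right _ _) hg hlim hu
    _ ≤ _ := by
        gcongr
        linarith
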